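/- Let $\mu>-\tfrac12$ be real and let $L^2_\mu(\mathbb R)$ be the Hilbert space of measurable $f:\mathbb R\to\mathbb C$ with $\int_{\mathbb R}|f(x)|^2|x|^{2\mu}\,dx<\infty$. Put $$\gamma_\mu(2m)=\frac{2^{2m}m!\,\Gamma(m+\mu+\frac12)}{\Gamma(\mu+\frac12)},\qquad \gamma_\mu(2m+1)=\frac{2^{2m+1}m!\,\Gamma(m+\mu+\frac32)}{\Gamma(\mu+\frac12)},\qquad \mathbf e_\mu(z)=\sum_{m\ge 0}\frac{z^m}{\gamma_\mu(m)},$$ let $H_n^\mu(x)=n!\sum_{0\le k\le n/2}\frac{(-1)^k(2x)^{n-2k}}{k!\,\gamma_\mu(n-2k)}$ be the generalized Hermite polynomials and $$\phi_n^\mu(x)=\Big(\frac{\gamma_\mu(n)}{\Gamma(\mu+\frac12)}\Big)^{1/2}\frac{1}{2^{n/2}\,n!}\,e^{-x^2/2}H_n^\mu(x)$$ the generalized Hermite functions. On the finite linear span of the $\phi_n^\mu$ ($n\ge0$) put $$P_\mu f(x)=-i\Big(f'(x)+\frac{\mu}{x}\big(f(x)-f(-x)\big)\Big),$$ and denote by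 $P_\mu$ also the closure of this operator in $L^2_\mu(\mathbb R)$. Then $P_\mu$ is self-adjoint, and for every $t>0$ and every $f\in L^2_\mu(\mathbb R)$ the integral $$(T_\mu(t)f)(x)=\frac{1}{(4t)^{\mu+1/2}\,\Gamma(\mu+\frac12)}\int_{\mathbb R}\exp\Big(-\frac{x^2+y^2}{4t}\Big)\,\mathbf e_\mu\Big(\frac{xy}{2t}\Big)f(y)\,|y|^{2\mu}\,dy$$ converges absolutely for every $x\in\mathbb R$, and $$T_\mu(t)f=\exp(-tP_\mu^2)f\quad\text{in }L^2_\mu(\mathbb R),$$ where $\exp(-tP_\mu^2)=\int_{\mathbb R}e^{-t\lambda^2}\,dE(\lambda)$ with $E$ the spectral measure of $P_\mu$. In particular $T_\mu(t)$, $t>0$, is a semigroup of bounded operators, $T_\mu(s+t)=T_\mu(s)T_\mu(t)$, with $T_\mu(t)f\to f$ in $L^2_\mu(\mathbb R)$ as $t\downarrow0$ (the generalized Gauss–Weierstrass heat semigroup). -/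

import Mathlib

open MeasureTheory Filter Topology
open scoped ENNReal Nat InnerProductSpace

noncomputable section

/-! ## Spectral measures and functions of an unbounded self-adjoint operator -/

section Spectral

variable {H : Type*} [NormedAddCommGroup H] [InnerProductSpace ℂ H] [CompleteSpace H]

/-- A spectral measure (projection-valued measure, resolution of the identity) on the Borel sets
of the real line, with values in the orthogonal projections of the Hilbert space `H`. The values
of `proj` on sets that are not measurable are irrelevant. -/
structure SpectralMeasure (H : Type*) [NormedAddCommGroup H] [InnerProductSpace ℂ H]
    [CompleteSpace H] where
  /-- The projection attached to a Borel set. -/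
  proj : Set ℝ → H →L[ℂ] H
  isStarProjection_proj : ∀ s, MeasurableSet s → IsStarProjection (proj s)
  proj_univ : proj Set.univ = 1
  proj_inter : ∀ s t, MeasurableSet s → MeasurableSet t → proj (s ∩ t) = proj s * proj t
  hasSum_proj_iUnion : ∀ s : ℕ → Set ℝ, (∀ i, MeasurableSet (s i)) →
    Pairwise (Function.onFun Disjoint s) →
      ∀ x : H, HasSum (fun i => proj (s i) x) (proj (⋃ i, s i) x)

namespace SpectralMeasure

theorem proj_empty_apply (E : SpectralMeasure H) (x : H) : E.proj ∅ x = 0 := by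
  have h := E.hasSum_proj_iUnion (fun _ => ∅) (fun _ => MeasurableSet.empty)
    (fun _ _ _ => by simp [Function.onFun]) x
  exact (summable_const_iff _).1 h.summable

theorem re_inner_proj_nonneg (E : SpectralMeasure H) {s : Set ℝ} (hs : MeasurableSet s) (x : H) :
    0 ≤ (⟪x, E.proj s x⟫_ℂ).re := by
  have h := E.isStarProjection_proj s hs
  have h1 : E.proj s x = E.proj s (E.proj s x) := by
    conv_lhs => rw [← h.isIdempotentElem.eq]
    rfl
  have h2 : ⟪x, E.proj s x⟫_ℂ = ⟪E.proj s x, E.proj s x⟫_ℂ := by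
    have h3 := ContinuousLinearMap.adjoint_inner_left (E.proj s) (E.proj s x) x
    rw [← ContinuousLinearMap.star_eq_adjoint, h.isSelfAdjoint.star_eq, ← h1] at h3
    exact h3.symm
  rw [h2]
  exact inner_self_nonneg (𝕜 := ℂ)

/-- The finite Borel measure `s ↦ ⟪x, E(s) x⟫ = ‖E(s) x‖²`. -/
def diag (E : SpectralMeasure H) (x : H) : Measure ℝ :=
  Measure.ofMeasurable (fun s _ => ENNReal.ofReal (⟪x, E.proj s x⟫_ℂ).re)
    (by simp [E.proj_empty_apply x])
    (by
      intro s hs hd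
      have h := E.hasSum_proj_iUnion s hs hd x
      have h2 : HasSum (fun i => (⟪x, E.proj (s i) x⟫_ℂ).re)
          (⟪x, E.proj (⋃ i, s i) x⟫_ℂ).re :=
        Complex.hasSum_re (h.mapL (innerSL ℂ x))
      rw [← h2.tsum_eq]
      exact ENNReal.ofReal_tsum_of_nonneg (fun i => E.re_inner_proj_nonneg (hs i) x) h2.summable)

/-- `E` is the spectral measure of the operator `A`, i.e. `A = ∫ l dE(l)`: the domain of `A`
consists of the vectors `x` with `∫ l² d⟪x, E x⟫ < ∞`, and there
`⟪x, A x⟫ = ∫ l d⟪x, E x⟫`. (By polarization the diagonal values determine `A`.) -/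
def IsSpectralMeasureOf (E : SpectralMeasure H) (A : H →ₗ.[ℂ] H) : Prop :=
  (∀ x : H, x ∈ A.domain ↔ Integrable (fun l : ℝ => l ^ 2) (E.diag x)) ∧
    ∀ x : A.domain, ⟪(x : H), A x⟫_ℂ = ((∫ l : ℝ, l ∂(E.diag (x : H)) : ℝ) : ℂ)

/-- `B = ∫ f(l) dE(l)` for a bounded Borel function `f`. (By polarization the diagonal values
determine `B`.) -/
def IsIntegral (E : SpectralMeasure H) (f : ℝ → ℝ) (B : H →L[ℂ] H) : Prop :=
  ∀ x : H, ⟪x, B x⟫_ℂ = ((∫ l : ℝ, f l ∂(E.diag x) : ℝ) : ℂ)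

end SpectralMeasure

/-- For a self-adjoint operator `A` and a bounded Borel function `f`: the bounded operator `B` is
`f(A)` in the sense of the functional calculus, i.e. `B = ∫ f dE` with `E` the spectral measure
of `A`. -/
def IsBorelFunctionOf (A : H →ₗ.[ℂ] H) (f : ℝ → ℝ) (B : H →L[ℂ] H) : Prop :=
  ∃ E : SpectralMeasure H, E.IsSpectralMeasureOf A ∧ E.IsIntegral f B

end Spectral

/-! ## The generalized exponential, Hermite functions and the operator `P` -/

namespace BoseLike

/-- The measure `|t|^{2μ} dt` on the real line. -/
def weightMeasure (μ : ℝ) : Measure ℝ :=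
  volume.withDensity fun t => ENNReal.ofReal (|t| ^ (2 * μ))

/-- The complex Hilbert space of the functions that are square integrable against
`|t|^{2μ} dt`. -/
abbrev L2 (μ : ℝ) : Type := Lp ℂ 2 (weightMeasure μ)

/-- The generalized factorial: `γ(2m) = 2^{2m} m! Γ(m+μ+1/2) / Γ(μ+1/2)` and
`γ(2m+1) = 2^{2m+1} m! Γ(m+μ+3/2) / Γ(μ+1/2)`. -/
def genFactorial (μ : ℝ) (n : ℕ) : ℝ :=
  2 ^ n * ((n / 2)! : ℝ) * Real.Gamma (((n + 1) / 2 : ℕ) + μ + 1 / 2) / Real.Gamma (μ + 1 / 2)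

/-- The generalized exponential, the entire function `e_μ(z) = ∑ zᵐ / γ_μ(m)`. -/
def genExp (μ : ℝ) (z : ℂ) : ℂ :=
  ∑' m : ℕ, z ^ m / (genFactorial μ m : ℂ)

/-- The generalized Hermite polynomials
`H_n(x) = n! ∑_{k ≤ n/2} (-1)^k (2x)^{n-2k} / (k! γ_μ(n-2k))`. -/
def genHermite (μ : ℝ) (n : ℕ) (x : ℝ) : ℝ :=
  (n ! : ℝ) * ∑ k ∈ Finset.range (n / 2 + 1),
    (-1) ^ k * (2 * x) ^ (n - 2 * k) / ((k ! : ℝ) * genFactorial μ (n - 2 * k))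

/-- The (normalized) generalized Hermite functions, as functions on the line. -/
def hermiteFun (μ : ℝ) (n : ℕ) (x : ℝ) : ℂ :=
  ((Real.sqrt (genFactorial μ n / Real.Gamma (μ + 1 / 2)) / (2 ^ ((n : ℝ) / 2) * (n ! : ℝ)) *
    Real.exp (-x ^ 2 / 2) * genHermite μ n x : ℝ) : ℂ)

/-- The finite linear span of the generalized Hermite functions. -/
def hermiteSpan (μ : ℝ) : Submodule ℂ (ℝ → ℂ) :=
  Submodule.span ℂ (Set.range (hermiteFun μ))

/-- The differential-difference expression `-i (f'(x) + (μ/x) (f(x) - f(-x)))`. Its value at the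
single point `x = 0` plays no role below. -/
def momentumExpr (μ : ℝ) (f : ℝ → ℂ) (x : ℝ) : ℂ :=
  -Complex.I * (deriv f x + ((μ / x : ℝ) : ℂ) * (f x - f (-x)))

theorem differentiable_hermiteFun (μ : ℝ) (n : ℕ) : Differentiable ℝ (hermiteFun μ n) := by
  have h : Differentiable ℝ (fun x : ℝ =>
      Real.sqrt (genFactorial μ n / Real.Gamma (μ + 1 / 2)) / (2 ^ ((n : ℝ) / 2) * (n ! : ℝ)) *
        Real.exp (-x ^ 2 / 2) * genHermite μ n x) := by
    unfold genHermite
    fun_prop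
  exact Complex.ofRealCLM.differentiable.comp h

theorem differentiable_of_mem_hermiteSpan {μ : ℝ} {g : ℝ → ℂ} (hg : g ∈ hermiteSpan μ) :
    Differentiable ℝ g := by
  induction hg using Submodule.span_induction with
  | mem x hx => obtain ⟨n, rfl⟩ := hx; exact differentiable_hermiteFun μ n
  | zero => exact differentiable_const (0 : ℂ)
  | add x y _ _ hx hy => exact hx.add hy
  | smul a x _ hx => exact hx.const_smul a

/-- The graph of `P` on the finite span of the generalized Hermite functions, as a subspace of
`L2 μ × L2 μ`. -/
def momentumGraph (μ : ℝ) : Submodule ℂ (L2 μ × L2 μ) where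
  carrier := {p | ∃ g ∈ hermiteSpan μ, p.1 =ᵐ[weightMeasure μ] g ∧
    p.2 =ᵐ[weightMeasure μ] momentumExpr μ g}
  add_mem' := by
    rintro p q ⟨g, hg, hp1, hp2⟩ ⟨h, hh, hq1, hq2⟩
    refine ⟨g + h, add_mem hg hh, ?_, ?_⟩
    · exact (Lp.coeFn_add _ _).trans (hp1.add hq1)
    · refine (Lp.coeFn_add _ _).trans ((hp2.add hq2).trans (Eventually.of_forall fun x => ?_))
      have hd : deriv (g + h) x = deriv g x + deriv h x :=
        deriv_add (differentiable_of_mem_hermiteSpan hg x) (differentiable_of_mem_hermiteSpan hh x)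
      simp only [Pi.add_apply, momentumExpr, hd]
      ring
  zero_mem' := by
    refine ⟨0, zero_mem _, Lp.coeFn_zero _ _ _, ?_⟩
    refine (Lp.coeFn_zero _ _ _).trans (Eventually.of_forall fun x => ?_)
    simp [momentumExpr]
  smul_mem' := by
    rintro c p ⟨g, hg, hp1, hp2⟩
    refine ⟨c • g, Submodule.smul_mem _ c hg, ?_, ?_⟩
    · exact (Lp.coeFn_smul _ _).trans (hp1.const_smul c)
    · refine (Lp.coeFn_smul _ _).trans ((hp2.const_smul c).trans (Eventually.of_forall fun x => ?_))
      have hd : deriv (c • g) x = c • deriv g x :=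
        deriv_const_smul c (differentiable_of_mem_hermiteSpan hg x)
      simp only [Pi.smul_apply, momentumExpr, hd, smul_eq_mul]
      ring

theorem volume_absolutelyContinuous_weightMeasure (μ : ℝ) : volume ≪ weightMeasure μ := by
  unfold weightMeasure
  refine withDensity_absolutelyContinuous' (by fun_prop) ?_
  have h : ∀ᵐ t : ℝ, t ≠ 0 := by simp [ae_iff, measure_singleton]
  filter_upwards [h] with t ht
  have : 0 < |t| ^ (2 * μ) := Real.rpow_pos_of_pos (abs_pos.2 ht) _
  simpa using this

/-- The graph above is single-valued. -/
theorem momentumGraph_functional (μ : ℝ) (p : L2 μ × L2 μ) (hp : p ∈ momentumGraph μ)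
    (h0 : p.1 = 0) : p.2 = 0 := by
  obtain ⟨g, hg, h1, h2⟩ := hp
  have hg0 : g =ᵐ[volume] (0 : ℝ → ℂ) := by
    apply (volume_absolutelyContinuous_weightMeasure μ).ae_le
    rw [h0] at h1
    exact h1.symm.trans (Lp.coeFn_zero _ _ _)
  have hg1 : g = 0 := Measure.eq_of_ae_eq hg0
    (differentiable_of_mem_hermiteSpan hg).continuous continuous_const
  rw [Lp.eq_zero_iff_ae_eq_zero]
  refine h2.trans (Eventually.of_forall fun x => ?_)
  simp [momentumExpr, hg1]

/-- `P` on the finite span of the generalized Hermite functions. -/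
def momentumCore (μ : ℝ) : L2 μ →ₗ.[ℂ] L2 μ := (momentumGraph μ).toLinearPMap

theorem momentumCore_graph (μ : ℝ) : (momentumCore μ).graph = momentumGraph μ :=
  Submodule.toLinearPMap_graph_eq _ (momentumGraph_functional μ)

/-- The operator `P`: the closure of its restriction to the finite span of the generalized Hermite
functions. -/
def momentum (μ : ℝ) : L2 μ →ₗ.[ℂ] L2 μ := (momentumCore μ).closure

/-- The function `(4t)^{-μ-1/2} Γ(μ+1/2)⁻¹ exp(-(x²+y²)/(4t)) e_μ(xy/(2t))`. -/
def heatKernel (μ t x y : ℝ) : ℂ :=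
  ((1 / ((4 * t) ^ (μ + 1 / 2) * Real.Gamma (μ + 1 / 2)) *
    Real.exp (-(x ^ 2 + y ^ 2) / (4 * t)) : ℝ) : ℂ) * genExp μ ((x * y / (2 * t) : ℝ) : ℂ)

/-- The integrand of the integral operator `T_μ(t)` applied to `f`, at the point `x`. -/
def heatIntegrand (μ t : ℝ) (f : ℝ → ℂ) (x y : ℝ) : ℂ :=
  heatKernel μ t x y * f y * ((|y| ^ (2 * μ) : ℝ) : ℂ)

/-- The integral operator `T_μ(t)`. -/
def heatOperator (μ t : ℝ) (f : ℝ → ℂ) (x : ℝ) : ℂ :=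
  ∫ y, heatIntegrand μ t f x y

end BoseLike

end

/-!
Let `φ_n` be the generalized Hermite functions. They form a Hilbert basis of `L2 μ`: multiplication
by `x` is symmetric and given by a Jacobi matrix in the `φ_n`, which reduces orthonormality to the
Gaussian moments `⟪φ_0, φ_n⟫`; and if `h` is orthogonal to all `φ_n`, then `exp (-x²/2) h` has
vanishing moments and exponential decay, so `h = 0`.

The Dunkl transform `U : φ_n ↦ (-i)ⁿ φ_n` is therefore unitary. Position and momentum are given by
the same Jacobi matrix up to the phases `(-i)ⁿ`, so `U` carries the momentum operator on the span of
the `φ_n` to multiplication by `x`, and its closure to the maximal multiplication operator. Hence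
`P` is self-adjoint and `exp (-t P²)` is `U⁻¹ exp (-t x²) U`.

The functions `exp (-s x²) e_μ(a x)` span a dense subspace. The Dunkl transform, multiplication by
Gaussians and the integral operator `T_μ(t)` permute them up to scalars, by the generalized Weber
integral `∫ exp (-s x²) e_μ(a x) e_μ(b x) |x|^(2μ) dx`, and comparing the scalars shows that
`T_μ(t)` and `exp (-t P²)` agree on them. For fixed `x` the integral `T_μ(t) f (x)` is a continuous
functional of `f`, so the identity extends to all of `L2 μ`.
-/

noncomputable section

/-! ### Operators diagonalized by a unitary map onto an `L²` space -/

section Multiplier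

variable {α : Type*} [MeasurableSpace α] {ν : Measure α}
variable {H : Type*} [NormedAddCommGroup H] [InnerProductSpace ℂ H] (U : H ≃ₗᵢ[ℂ] Lp ℂ 2 ν)

open Classical in
/-- The bounded operator on `H` which the unitary map `U` carries to multiplication by the
essentially bounded function `m`; it is `0` if `m` is not essentially bounded. -/
def multiplier (m : α → ℝ) : H →L[ℂ] H :=
  if hm : MemLp m ∞ ν then
    (U.symm.toContinuousLinearEquiv : Lp ℂ 2 ν →L[ℂ] H) ∘L
      (ContinuousLinearMap.mul ℂ ℂ).holderL ν ∞ 2 2 (hm.ofReal.toLp _) ∘L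
        (U.toContinuousLinearEquiv : H →L[ℂ] Lp ℂ 2 ν)
  else 0

/-- The graph of the operator on `H` which the unitary map `U` carries to multiplication by the
(possibly unbounded) function `ψ`, on its maximal domain. -/
def multiplierGraph (ψ : α → ℝ) : Submodule ℂ (H × H) where
  carrier := {p | U p.2 =ᵐ[ν] fun a => (ψ a : ℂ) * U p.1 a}
  add_mem' {p q} hp hq := by
    simp only [Set.mem_ofPred_eq, Prod.fst_add, Prod.snd_add, map_add] at hp hq ⊢
    filter_upwards [hp, hq, Lp.coeFn_add (U p.1) (U q.1), Lp.coeFn_add (U p.2) (U q.2)]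
      with a hpa hqa hadd₁ hadd₂
    rw [hadd₁, hadd₂, Pi.add_apply, Pi.add_apply, hpa, hqa, mul_add]
  zero_mem' := by
    simp only [Set.mem_ofPred_eq, Prod.fst_zero, Prod.snd_zero, map_zero]
    filter_upwards [Lp.coeFn_zero ℂ 2 ν] with a hzero
    rw [hzero, Pi.zero_apply, mul_zero]
  smul_mem' c p hp := by
    simp only [Set.mem_ofPred_eq, Prod.smul_fst, Prod.smul_snd, map_smul] at hp ⊢
    filter_upwards [hp, Lp.coeFn_smul c (U p.1), Lp.coeFn_smul c (U p.2)] with a hpa hsmul₁ hsmul₂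
    rw [hsmul₁, hsmul₂, Pi.smul_apply, Pi.smul_apply, hpa, smul_eq_mul, smul_eq_mul,
      mul_left_comm]

variable {U} {m k ψ : α → ℝ}

theorem mem_multiplierGraph {p : H × H} :
    p ∈ multiplierGraph U ψ ↔ U p.2 =ᵐ[ν] fun a => (ψ a : ℂ) * U p.1 a :=
  Iff.rfl

theorem coeFn_multiplier (hm : MemLp m ∞ ν) (x : H) :
    U (multiplier U m x) =ᵐ[ν] fun a => (m a : ℂ) * U x a := by
  rw [multiplier, dif_pos hm]
  filter_upwards [ContinuousLinearMap.coeFn_holder (r := 2) (ContinuousLinearMap.mul ℂ ℂ)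
    (hm.ofReal.toLp _) (U x), MemLp.coeFn_toLp (hm.ofReal (K := ℂ))] with a h_holder h_toLp
  rw [ContinuousLinearMap.mul_apply', h_toLp] at h_holder
  simpa using h_holder

theorem multiplier_eq_iff (hm : MemLp m ∞ ν) {x y : H} :
    multiplier U m x = y ↔ U y =ᵐ[ν] fun a => (m a : ℂ) * U x a :=
  ⟨fun h => h ▸ coeFn_multiplier hm x,
    fun h => U.injective (Lp.ext ((coeFn_multiplier hm x).trans h.symm))⟩

theorem multiplier_one : multiplier U 1 = 1 :=
  ContinuousLinearMap.ext fun _ => (multiplier_eq_iff (memLp_top_const 1)).2 (by simp)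

theorem multiplier_zero : multiplier U 0 = 0 := by
  refine ContinuousLinearMap.ext fun _ => (multiplier_eq_iff (memLp_top_const 0)).2 ?_
  filter_upwards [Lp.coeFn_zero ℂ 2 ν] with a hzero
  simpa using hzero

theorem multiplier_add (hm : MemLp m ∞ ν) (hk : MemLp k ∞ ν) :
    multiplier U (m + k) = multiplier U m + multiplier U k := by
  refine ContinuousLinearMap.ext fun x => (multiplier_eq_iff (hm.add hk)).2 ?_
  rw [add_apply, map_add]
  filter_upwards [coeFn_multiplier (U := U) hm x, coeFn_multiplier (U := U) hk x,
    Lp.coeFn_add (U (multiplier U m x)) (U (multiplier U k x))] with a hma hka hadd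
  rw [hadd, Pi.add_apply, hma, hka, Pi.add_apply, Complex.ofReal_add, add_mul]

theorem multiplier_sum {ι : Type*} {m : ι → α → ℝ} (hm : ∀ i, MemLp (m i) ∞ ν) (F : Finset ι) :
    multiplier U (∑ i ∈ F, m i) = ∑ i ∈ F, multiplier U (m i) := by
  classical
  induction F using Finset.induction_on with
  | empty => simpa using multiplier_zero
  | insert i F hi ih =>
    rw [Finset.sum_insert hi, Finset.sum_insert hi,
      multiplier_add (hm i) (memLp_finsetSum' F fun i _ => hm i), ih]

theorem multiplier_mul (hm : MemLp m ∞ ν) (hk : MemLp k ∞ ν) :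
    multiplier U (m * k) = (multiplier U m).comp (multiplier U k) := by
  refine ContinuousLinearMap.ext fun x => (multiplier_eq_iff (hk.mul hm)).2 ?_
  rw [ContinuousLinearMap.comp_apply]
  filter_upwards [coeFn_multiplier (U := U) hm (multiplier U k x),
    coeFn_multiplier (U := U) hk x] with a hma hka
  rw [hma, hka, Pi.mul_apply, Complex.ofReal_mul, mul_assoc]

theorem inner_eq_integral (x y : H) : ⟪x, y⟫_ℂ = ∫ a, ⟪U x a, U y a⟫_ℂ ∂ν := by
  rw [← U.inner_map_map, L2.inner_def]

theorem isSymmetric_multiplier (hm : MemLp m ∞ ν) :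
    (multiplier U m : H →ₗ[ℂ] H).IsSymmetric := by
  intro x y
  rw [inner_eq_integral (U := U), inner_eq_integral (U := U)]
  refine integral_congr_ae ?_
  filter_upwards [coeFn_multiplier (U := U) hm x, coeFn_multiplier (U := U) hm y] with a hx hy
  simp only [ContinuousLinearMap.coe_coe, hx, hy, RCLike.inner_apply, map_mul, Complex.conj_ofReal]
  ring

theorem inner_eq_integral_mul_norm_sq {x y : H} (h : U y =ᵐ[ν] fun a => (m a : ℂ) * U x a) :
    ⟪x, y⟫_ℂ = ((∫ a, m a * ‖U x a‖ ^ 2 ∂ν : ℝ) : ℂ) := by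
  rw [inner_eq_integral (U := U), ← integral_complex_ofReal]
  refine integral_congr_ae ?_
  filter_upwards [h] with a ha
  simp only [ha, RCLike.inner_apply, mul_assoc, Complex.mul_conj', Complex.ofReal_mul,
    Complex.ofReal_pow]

theorem integrable_norm_sq_coeFn (f : Lp ℂ 2 ν) : Integrable (fun a => ‖f a‖ ^ 2) ν :=
  (memLp_two_iff_integrable_sq_norm (Lp.aestronglyMeasurable f)).1 (Lp.memLp f)

theorem norm_sq_eq_integral (x : H) : ‖x‖ ^ 2 = ∫ a, ‖U x a‖ ^ 2 ∂ν := by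
  have h := inner_eq_integral_mul_norm_sq (U := U) (m := 1) (x := x) (y := x) (by simp)
  rw [inner_self_eq_norm_sq_to_K] at h
  exact Complex.ofReal_injective (by simpa using h)

theorem tendsto_multiplier {ι : Type*} {l : Filter ι} [l.IsCountablyGenerated] {m : ι → α → ℝ}
    {C : ℝ} (hm : ∀ᶠ i in l, AEStronglyMeasurable (m i) ν) (hC : ∀ᶠ i in l, ∀ a, ‖m i a‖ ≤ C)
    (hk : MemLp k ∞ ν) (hlim : ∀ a, Tendsto (fun i => m i a) l (𝓝 (k a))) (x : H) :
    Tendsto (fun i => multiplier U (m i) x) l (𝓝 (multiplier U k x)) := by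
  rcases l.eq_or_neBot with rfl | _
  · exact tendsto_bot
  have hkC : ∀ a, ‖k a‖ ≤ C := fun a =>
    le_of_tendsto (hlim a).norm (hC.mono fun i hi => hi a)
  have hnorm : ∀ᶠ i in l, ‖multiplier U (m i) x - multiplier U k x‖ ^ 2 =
      ∫ a, (m i a - k a) ^ 2 * ‖U x a‖ ^ 2 ∂ν := by
    filter_upwards [hm, hC] with i hmi hCi
    have hmi_top : MemLp (m i) ∞ ν := memLp_top_of_bound hmi C (ae_of_all ν hCi)
    rw [norm_sq_eq_integral (U := U), map_sub]
    refine integral_congr_ae ?_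
    filter_upwards [coeFn_multiplier (U := U) hmi_top x, coeFn_multiplier (U := U) hk x,
      Lp.coeFn_sub (U (multiplier U (m i) x)) (U (multiplier U k x))] with a hma hka hsub
    rw [hsub, Pi.sub_apply, hma, hka, ← sub_mul, ← Complex.ofReal_sub, norm_mul, mul_pow,
      Complex.norm_real, Real.norm_eq_abs, sq_abs]
  have h_integral : Tendsto (fun i => ∫ a, (m i a - k a) ^ 2 * ‖U x a‖ ^ 2 ∂ν) l
      (𝓝 (∫ _, (0 : ℝ) ∂ν)) := by
    refine tendsto_integral_filter_of_dominated_convergence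
      (fun a => (C + C) ^ 2 * ‖U x a‖ ^ 2) ?_ ?_
      ((integrable_norm_sq_coeFn (U x)).const_mul _) (ae_of_all ν fun a => ?_)
    · filter_upwards [hm] with i hmi
      exact ((hmi.sub hk.1).pow 2).mul (integrable_norm_sq_coeFn (U x)).1
    · filter_upwards [hC] with i hCi
      refine ae_of_all ν fun a => ?_
      rw [norm_mul, norm_pow, norm_pow, norm_norm]
      gcongr
      exact norm_sub_le_of_le (hCi a) (hkC a)
    · simpa using (((hlim a).sub_const (k a)).pow 2).mul_const (‖U x a‖ ^ 2)
  rw [integral_zero] at h_integral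
  rw [tendsto_iff_norm_sub_tendsto_zero]
  simpa using (h_integral.congr' (hnorm.mono fun _ h => h.symm)).sqrt

theorem memLp_top_resolvent (hψ : AEStronglyMeasurable ψ ν) :
    MemLp (fun a => (1 + ψ a ^ 2)⁻¹) ∞ ν := by
  refine memLp_top_of_bound (by fun_prop) 1 (ae_of_all ν fun a => ?_)
  rw [norm_inv, Real.norm_of_nonneg (by positivity)]
  exact inv_le_one_of_one_le₀ (by nlinarith [sq_nonneg (ψ a)])

theorem memLp_top_mul_resolvent (hψ : AEStronglyMeasurable ψ ν) :
    MemLp (fun a => ψ a * (1 + ψ a ^ 2)⁻¹) ∞ ν := by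
  refine memLp_top_of_bound (by fun_prop) 1 (ae_of_all ν fun a => ?_)
  rw [← div_eq_mul_inv, norm_div, Real.norm_of_nonneg (by positivity : 0 ≤ 1 + ψ a ^ 2),
    div_le_one (by positivity), Real.norm_eq_abs]
  nlinarith [sq_abs (ψ a), sq_nonneg (|ψ a| - 1), abs_nonneg (ψ a)]

theorem mem_multiplierGraph_iff_resolvent (hψ : AEStronglyMeasurable ψ ν) {p : H × H} :
    p ∈ multiplierGraph U ψ ↔ multiplier U (fun a => (1 + ψ a ^ 2)⁻¹) p.2 =
      multiplier U (fun a => ψ a * (1 + ψ a ^ 2)⁻¹) p.1 := by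
  rw [multiplier_eq_iff (memLp_top_resolvent hψ), mem_multiplierGraph]
  have hpos : ∀ a, ((1 + ψ a ^ 2)⁻¹ : ℝ) ≠ 0 := fun a => by positivity
  refine eventually_congr ?_
  filter_upwards [coeFn_multiplier (U := U) (memLp_top_mul_resolvent hψ) p.1] with a ha
  rw [ha, Complex.ofReal_mul, mul_comm (ψ a : ℂ) (((1 + ψ a ^ 2)⁻¹ : ℝ) : ℂ), mul_assoc, eq_comm,
    mul_right_inj' (Complex.ofReal_ne_zero.2 (hpos a)), eq_comm]

theorem resolvent_mem_multiplierGraph (hψ : AEStronglyMeasurable ψ ν) (x : H) :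
    (multiplier U (fun a => (1 + ψ a ^ 2)⁻¹) x,
      multiplier U (fun a => ψ a * (1 + ψ a ^ 2)⁻¹) x) ∈ multiplierGraph U ψ := by
  rw [mem_multiplierGraph]
  filter_upwards [coeFn_multiplier (U := U) (memLp_top_resolvent hψ) x,
    coeFn_multiplier (U := U) (memLp_top_mul_resolvent hψ) x] with a h_res h_mul
  rw [h_res, h_mul, Complex.ofReal_mul, mul_assoc]

theorem isClosed_multiplierGraph (hψ : AEStronglyMeasurable ψ ν) :
    IsClosed (multiplierGraph U ψ : Set (H × H)) := by
  simp only [← SetLike.setOfPred_mem_eq, mem_multiplierGraph_iff_resolvent hψ]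
  exact isClosed_eq (by fun_prop) (by fun_prop)

theorem norm_le_norm_add_I_smul {p : H × H} (hp : p ∈ multiplierGraph U ψ) :
    ‖p‖ ≤ ‖p.2 + Complex.I • p.1‖ := by
  have hpythagoras : ‖p.2 + Complex.I • p.1‖ ^ 2 = ‖p.2‖ ^ 2 + ‖p.1‖ ^ 2 := by
    rw [norm_add_sq (𝕜 := ℂ), inner_smul_right, ← inner_conj_symm,
      inner_eq_integral_mul_norm_sq (mem_multiplierGraph.1 hp), norm_smul]
    simp
  refine max_le ?_ ?_
  · exact le_of_sq_le_sq (by nlinarith [sq_nonneg ‖p.2‖]) (norm_nonneg _)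
  · exact le_of_sq_le_sq (by nlinarith [sq_nonneg ‖p.1‖]) (norm_nonneg _)

theorem topologicalClosure_eq_multiplierGraph (hψ : AEStronglyMeasurable ψ ν)
    {K : Submodule ℂ (H × H)} (hK : K ≤ multiplierGraph U ψ)
    (hdense : Dense ((fun p : H × H => p.2 + Complex.I • p.1) '' K)) :
    K.topologicalClosure = multiplierGraph U ψ := by
  refine le_antisymm (K.topologicalClosure_minimal hK (isClosed_multiplierGraph hψ))
    fun p hp => Metric.mem_closure_iff.2 fun ε hε => ?_
  obtain ⟨_, ⟨q, hq, rfl⟩, hpq⟩ := hdense.exists_dist_lt (p.2 + Complex.I • p.1) hε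
  refine ⟨q, hq, ?_⟩
  rw [dist_eq_norm] at hpq ⊢
  calc ‖p - q‖ ≤ ‖(p - q).2 + Complex.I • (p - q).1‖ :=
        norm_le_norm_add_I_smul (sub_mem hp (hK hq))
    _ = ‖p.2 + Complex.I • p.1 - (q.2 + Complex.I • q.1)‖ := by
        rw [Prod.snd_sub, Prod.fst_sub, smul_sub, sub_add_sub_comm]
    _ < ε := hpq

variable [CompleteSpace H]

theorem denseRange_resolvent (hψ : AEStronglyMeasurable ψ ν) :
    DenseRange (multiplier U fun a => (1 + ψ a ^ 2)⁻¹) := by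
  rw [DenseRange, ← ContinuousLinearMap.coe_coe, ← LinearMap.coe_range,
    Submodule.dense_iff_topologicalClosure_eq_top, Submodule.topologicalClosure_eq_top_iff,
    (isSymmetric_multiplier (memLp_top_resolvent hψ)).orthogonal_range, LinearMap.ker_eq_bot']
  intro x hx
  have hae := (multiplier_eq_iff (memLp_top_resolvent hψ)).1 hx
  refine (map_eq_zero_iff U U.injective).1 ((Lp.eq_zero_iff_ae_eq_zero).2 ?_)
  rw [map_zero] at hae
  filter_upwards [hae, Lp.coeFn_zero ℂ 2 ν] with a ha hzero
  rw [hzero, Pi.zero_apply, eq_comm, mul_eq_zero, Complex.ofReal_eq_zero] at ha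
  exact ha.resolve_left (by positivity)

theorem isSelfAdjoint_of_graph_eq_multiplierGraph (hψ : AEStronglyMeasurable ψ ν)
    {A : H →ₗ.[ℂ] H} (hA : A.graph = multiplierGraph U ψ) : IsSelfAdjoint A := by
  have hdomain : Dense (A.domain : Set H) := by
    refine (denseRange_resolvent (U := U) hψ).mono ?_
    rintro _ ⟨x, rfl⟩
    exact LinearPMap.mem_domain_of_mem_graph (hA ▸ resolvent_mem_multiplierGraph hψ x)
  rw [LinearPMap.isSelfAdjoint_def]
  refine LinearPMap.eq_of_eq_graph ?_
  rw [LinearPMap.adjoint_graph_eq_graph_adjoint hdomain, hA]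
  ext p
  rw [Submodule.mem_adjoint_iff]
  refine ⟨fun h => ?_, fun hp a b hab => ?_⟩
  · rw [mem_multiplierGraph_iff_resolvent hψ]
    refine ext_inner_left ℂ fun y => (sub_eq_zero.1 ?_).symm
    have h_test := h _ _ (resolvent_mem_multiplierGraph hψ y)
    rwa [← ContinuousLinearMap.coe_coe, isSymmetric_multiplier (memLp_top_mul_resolvent hψ),
      ← ContinuousLinearMap.coe_coe, isSymmetric_multiplier (memLp_top_resolvent hψ)] at h_test
  · rw [sub_eq_zero, inner_eq_integral (U := U), inner_eq_integral (U := U)]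
    refine integral_congr_ae ?_
    filter_upwards [mem_multiplierGraph.1 hp, mem_multiplierGraph.1 hab] with y hpy haby
    rw [hpy, haby]
    simp only [RCLike.inner_apply, map_mul, Complex.conj_ofReal]
    ring

/-- The spectral measure, carried back to `H` along `U`, of multiplication by `ψ`: the projection
attached to `s` is multiplication by the indicator function of `ψ ⁻¹' s`. -/
def multiplierSpectralMeasure (U : H ≃ₗᵢ[ℂ] Lp ℂ 2 ν) (hψ : Measurable ψ) :
    SpectralMeasure H where
  proj s := multiplier U ((ψ ⁻¹' s).indicator 1)
  isStarProjection_proj s hs := by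
    have h_memLp : MemLp ((ψ ⁻¹' s).indicator (1 : α → ℝ)) ∞ ν :=
      (memLp_top_const 1).indicator (hψ hs)
    refine ⟨?_, (isSymmetric_multiplier h_memLp).isSelfAdjoint⟩
    rw [IsIdempotentElem, ContinuousLinearMap.mul_def, ← multiplier_mul h_memLp h_memLp,
      ← Set.inter_indicator_one, Set.inter_self]
  proj_univ := by simpa using multiplier_one
  proj_inter s t hs ht := by
    have h_memLp : ∀ {u : Set ℝ}, MeasurableSet u → MemLp ((ψ ⁻¹' u).indicator (1 : α → ℝ)) ∞ ν :=
      fun hu => (memLp_top_const 1).indicator (hψ hu)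
    rw [ContinuousLinearMap.mul_def, ← multiplier_mul (h_memLp hs) (h_memLp ht),
      ← Set.inter_indicator_one, Set.preimage_inter]
  hasSum_proj_iUnion s hs hdisj x := by
    have h_memLp : ∀ i, MemLp ((ψ ⁻¹' s i).indicator (1 : α → ℝ)) ∞ ν := fun i =>
      (memLp_top_const 1).indicator (hψ (hs i))
    have h_biUnion : ∀ F : Finset ℕ, ∑ i ∈ F, (ψ ⁻¹' s i).indicator (1 : α → ℝ) =
        (⋃ i ∈ F, ψ ⁻¹' s i).indicator 1 := fun F => by
      rw [Finset.indicator_biUnion F _ fun i _ j _ hij => (hdisj hij).preimage ψ]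
      exact Finset.sum_fn ..
    simp only [HasSum, SummationFilter.unconditional_filter, ← sum_apply, ← multiplier_sum h_memLp,
      h_biUnion, Set.preimage_iUnion]
    refine tendsto_multiplier (C := 1) (Eventually.of_forall fun F => ?_)
      (Eventually.of_forall fun F a => (norm_indicator_le_norm_self 1 a).trans_eq norm_one)
      ((memLp_top_const 1).indicator (.iUnion fun i => hψ (hs i)))
      (fun a => (tendsto_indicator_biUnion_finset _ _ a).mono_right (pure_le_nhds _)) x
    exact (aestronglyMeasurable_const.indicator (F.measurableSet_biUnion fun i _ => hψ (hs i)))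

theorem diag_multiplierSpectralMeasure (hψ : Measurable ψ) (x : H) :
    (multiplierSpectralMeasure U hψ).diag x =
      (ν.withDensity fun a => ENNReal.ofReal (‖U x a‖ ^ 2)).map ψ := by
  ext s hs
  rw [SpectralMeasure.diag, Measure.ofMeasurable_apply s hs, Measure.map_apply hψ hs,
    withDensity_apply _ (hψ hs),
    ← ofReal_integral_eq_lintegral_ofReal (integrable_norm_sq_coeFn (U x)).integrableOn
      (ae_of_all _ fun a => by positivity)]
  have h_memLp : MemLp ((ψ ⁻¹' s).indicator (1 : α → ℝ)) ∞ ν :=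
    (memLp_top_const 1).indicator (hψ hs)
  have h_inner := inner_eq_integral_mul_norm_sq (coeFn_multiplier (U := U) h_memLp x)
  simp only [multiplierSpectralMeasure, h_inner, Complex.ofReal_re, ← integral_indicator (hψ hs)]
  congr 2 with a
  by_cases ha : a ∈ ψ ⁻¹' s <;> simp [ha]

theorem integral_diag_multiplierSpectralMeasure (hψ : Measurable ψ) (x : H) {f : ℝ → ℝ}
    (hf : Measurable f) : ∫ l, f l ∂(multiplierSpectralMeasure U hψ).diag x =
      ∫ a, f (ψ a) * ‖U x a‖ ^ 2 ∂ν := by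
  rw [diag_multiplierSpectralMeasure, integral_map hψ.aemeasurable hf.aestronglyMeasurable,
    integral_withDensity_eq_integral_toReal_smul₀ (by fun_prop) (by simp)]
  simp [mul_comm]

theorem integrable_diag_multiplierSpectralMeasure_iff (hψ : Measurable ψ) (x : H) {f : ℝ → ℝ}
    (hf : Measurable f) : Integrable f ((multiplierSpectralMeasure U hψ).diag x) ↔
      Integrable (fun a => f (ψ a) * ‖U x a‖ ^ 2) ν := by
  rw [diag_multiplierSpectralMeasure, integrable_map_measure hf.aestronglyMeasurable
    hψ.aemeasurable, integrable_withDensity_iff_integrable_smul₀' (by fun_prop) (by simp)]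
  simp [mul_comm]

theorem isSpectralMeasureOf_multiplierSpectralMeasure (hψ : Measurable ψ) {A : H →ₗ.[ℂ] H}
    (hA : A.graph = multiplierGraph U ψ) :
    (multiplierSpectralMeasure U hψ).IsSpectralMeasureOf A := by
  refine ⟨fun x => ?_, fun x => ?_⟩
  · have h_memLp : Integrable (fun a => ψ a ^ 2 * ‖U x a‖ ^ 2) ν ↔
        MemLp (fun a => (ψ a : ℂ) * U x a) 2 ν := by
      rw [memLp_two_iff_integrable_sq_norm (by fun_prop)]
      simp [mul_pow]
    rw [integrable_diag_multiplierSpectralMeasure_iff hψ x (by fun_prop), h_memLp]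
    refine ⟨fun hx => ?_, fun h => ?_⟩
    · obtain ⟨y, hxy⟩ := LinearPMap.mem_domain_iff.1 hx
      rw [hA, mem_multiplierGraph] at hxy
      exact (Lp.memLp (U y)).ae_eq hxy
    · refine LinearPMap.mem_domain_of_mem_graph (y := U.symm (h.toLp _)) ?_
      rw [hA, mem_multiplierGraph, LinearIsometryEquiv.apply_symm_apply]
      exact h.coeFn_toLp
  · have h_graph : ((x : H), A x) ∈ multiplierGraph U ψ := hA ▸ A.mem_graph x
    rw [inner_eq_integral_mul_norm_sq (mem_multiplierGraph.1 h_graph),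
      integral_diag_multiplierSpectralMeasure hψ (x : H) (f := fun l => l) measurable_id]

theorem isBorelFunctionOf_multiplier (hψ : Measurable ψ) {A : H →ₗ.[ℂ] H}
    (hA : A.graph = multiplierGraph U ψ) {f : ℝ → ℝ} (hf : Measurable f)
    (hf_top : MemLp (fun a => f (ψ a)) ∞ ν) :
    IsBorelFunctionOf A f (multiplier U fun a => f (ψ a)) :=
  ⟨multiplierSpectralMeasure U hψ, isSpectralMeasureOf_multiplierSpectralMeasure hψ hA, fun x => by
    rw [inner_eq_integral_mul_norm_sq (coeFn_multiplier hf_top x),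
      integral_diag_multiplierSpectralMeasure hψ x hf]⟩

end Multiplier

section PhaseUnitary

variable {ι H : Type*} [NormedAddCommGroup H] [InnerProductSpace ℂ H] {c : ι → ℂ}

theorem orthonormal_smul {v : ι → H} (hv : Orthonormal ℂ v) (hc : ∀ i, ‖c i‖ = 1) :
    Orthonormal ℂ fun i => c i • v i := by
  refine ⟨fun i => by rw [norm_smul, hc, hv.1, one_mul], fun i j hij => ?_⟩
  simp only [inner_smul_left, inner_smul_right, hv.2 hij, mul_zero]

theorem ne_zero_of_norm_eq_one (hc : ∀ i, ‖c i‖ = 1) (i : ι) : c i ≠ 0 :=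
  norm_ne_zero_iff.1 ((hc i).trans_ne one_ne_zero)

variable [CompleteSpace H] (b : HilbertBasis ι ℂ H)

/-- The Hilbert basis obtained from `b` by multiplying its members with the phases `c`. -/
def phaseBasis (hc : ∀ i, ‖c i‖ = 1) : HilbertBasis ι ℂ H :=
  HilbertBasis.mkOfOrthogonalEqBot (orthonormal_smul b.orthonormal hc) <| by
    have h_span : Submodule.span ℂ (Set.range b) ≤
        Submodule.span ℂ (Set.range fun i => c i • b i) := by
      rw [Submodule.span_le]
      rintro _ ⟨i, rfl⟩
      rw [SetLike.mem_coe, ← inv_smul_smul₀ (ne_zero_of_norm_eq_one hc i) (b i)]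
      exact Submodule.smul_mem _ _ (Submodule.subset_span ⟨i, rfl⟩)
    rw [← Submodule.topologicalClosure_eq_top_iff, ← top_le_iff, ← b.dense_span]
    exact Submodule.topologicalClosure_mono h_span

/-- The unitary operator which is diagonal in the Hilbert basis `b`, with eigenvalues `c`. -/
def phaseUnitary (hc : ∀ i, ‖c i‖ = 1) : H ≃ₗᵢ[ℂ] H :=
  b.repr.trans (phaseBasis b hc).repr.symm

theorem phaseUnitary_apply_basis (hc : ∀ i, ‖c i‖ = 1) (i : ι) :
    phaseUnitary b hc (b i) = c i • b i := by
  classical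
  rw [phaseUnitary, LinearIsometryEquiv.trans_apply, HilbertBasis.repr_self,
    HilbertBasis.repr_symm_single, phaseBasis, HilbertBasis.coe_mkOfOrthogonalEqBot]

end PhaseUnitary

theorem ae_eq_apply_of_topologicalClosure_span_eq_top {α H E : Type*} [MeasurableSpace α]
    {ν : Measure α} {p : ℝ≥0∞} [Fact (1 ≤ p)] [NormedAddCommGroup H] [NormedSpace ℂ H]
    [NormedAddCommGroup E] [NormedSpace ℂ E] {D : Set H}
    (hD : (Submodule.span ℂ D).topologicalClosure = ⊤) (ℓ : α → H →L[ℂ] E)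
    (T : H →L[ℂ] Lp E p ν) (h : ∀ f ∈ D, (fun x => ℓ x f) =ᵐ[ν] T f) (f : H) :
    (fun x => ℓ x f) =ᵐ[ν] T f := by
  let agree : Submodule ℂ H :=
    { carrier := {f | (fun x => ℓ x f) =ᵐ[ν] T f}
      zero_mem' := by
        simp only [Set.mem_ofPred_eq, map_zero]
        exact (Lp.coeFn_zero E p ν).symm
      add_mem' := fun {f g} hf hg => by
        simp only [Set.mem_ofPred_eq, map_add] at hf hg ⊢
        exact (hf.add hg).trans (Lp.coeFn_add _ _).symm
      smul_mem' := fun c f hf => by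
        simp only [Set.mem_ofPred_eq, map_smul] at hf ⊢
        exact (hf.const_smul c).trans (Lp.coeFn_smul _ _).symm }
  have h_closed : IsClosed (agree : Set H) := by
    refine IsSeqClosed.isClosed fun u f hu hlim => ?_
    obtain ⟨ns, hns, h_tendsto⟩ := (tendstoInMeasure_of_tendsto_Lp
      ((T.continuous.tendsto f).comp hlim)).exists_seq_tendsto_ae
    filter_upwards [h_tendsto, ae_all_iff.2 hu] with x hx h_agree
    refine tendsto_nhds_unique ?_ hx
    simp only [Function.comp_apply, ← h_agree]
    exact ((ℓ x).continuous.tendsto f).comp (hlim.comp hns.tendsto_atTop)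
  have h_top : agree = ⊤ := by
    rw [eq_top_iff, ← hD]
    exact Submodule.topologicalClosure_minimal _ (Submodule.span_le.2 h) h_closed
  exact (h_top ▸ Submodule.mem_top : f ∈ agree)

/-! ### Determinacy of moments -/

section Moments

variable {ν : Measure ℝ}

theorem integral_ofReal_mul_exp_I_eq_zero_of_moments {h : ℝ → ℝ}
    (h_int : ∀ c : ℝ, Integrable (fun x => Real.exp (c * |x|) * h x) ν)
    (h_mom : ∀ n : ℕ, ∫ x, x ^ n * h x ∂ν = 0) (t : ℝ) :
    ∫ x, (h x : ℂ) * Complex.exp ((t * x : ℝ) * Complex.I) ∂ν = 0 := by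
  have h_meas : AEStronglyMeasurable h ν := by simpa using (h_int 0).aestronglyMeasurable
  have h_exp (x : ℝ) : HasSum (fun n : ℕ => |t * x| ^ n / (n ! : ℝ) * |h x|)
      (Real.exp (|t| * |x|) * |h x|) := by
    rw [Real.exp_eq_exp_ℝ, ← abs_mul]
    exact (NormedSpace.expSeries_div_hasSum_exp |t * x|).mul_right _
  have h_sum := hasSum_integral_of_dominated_convergence (μ := ν)
    (F := fun (n : ℕ) x => (h x : ℂ) * (((t * x : ℝ) * Complex.I) ^ n / (n ! : ℂ)))
    (f := fun x => (h x : ℂ) * Complex.exp ((t * x : ℝ) * Complex.I))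
    (fun n x => |t * x| ^ n / (n ! : ℝ) * |h x|)
    (fun n => (Complex.continuous_ofReal.comp_aestronglyMeasurable h_meas).mul (by fun_prop))
    (fun n => .of_forall fun x => by simp [abs_mul, mul_comm])
    (.of_forall fun x => (h_exp x).summable)
    (by simpa only [fun x => (h_exp x).tsum_eq, norm_mul, Real.norm_eq_abs, Real.abs_exp] using
      (h_int |t|).norm)
    (.of_forall fun x => by
      simpa only [Complex.exp_eq_exp_ℂ] using
        (NormedSpace.expSeries_div_hasSum_exp (((t * x : ℝ) : ℂ) * Complex.I)).mul_left (h x : ℂ))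
  have h_term (n : ℕ) :
      ∫ x, (h x : ℂ) * (((t * x : ℝ) * Complex.I) ^ n / (n ! : ℂ)) ∂ν = 0 := by
    calc _ = ∫ x, (t * Complex.I) ^ n / (n ! : ℂ) * ((x ^ n * h x : ℝ) : ℂ) ∂ν :=
          integral_congr_ae (.of_forall fun x => by push_cast; ring)
      _ = 0 := by
          rw [integral_const_mul, integral_complex_ofReal, h_mom, Complex.ofReal_zero, mul_zero]
  simp only [h_term] at h_sum
  exact h_sum.unique hasSum_zero

theorem charFun_withDensity_ofReal {h : ℝ → ℝ} (h_int : Integrable h ν) (t : ℝ) :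
    charFun (ν.withDensity fun x => ENNReal.ofReal (h x)) t =
      ∫ x, ((max (h x) 0 : ℝ) : ℂ) * Complex.exp ((t * x : ℝ) * Complex.I) ∂ν := by
  rw [charFun_apply, integral_withDensity_eq_integral_toReal_smul₀
    h_int.aemeasurable.ennreal_ofReal (.of_forall fun _ => ENNReal.ofReal_lt_top)]
  refine integral_congr_ae (.of_forall fun x => ?_)
  simp only [ENNReal.toReal_ofReal', Complex.real_smul]
  rfl

theorem ae_eq_zero_of_integral_ofReal_mul_exp_I_eq_zero {h : ℝ → ℝ} (h_int : Integrable h ν)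
    (h_fourier : ∀ t : ℝ, ∫ x, (h x : ℂ) * Complex.exp ((t * x : ℝ) * Complex.I) ∂ν = 0) :
    h =ᵐ[ν] 0 := by
  have isFinite {g : ℝ → ℝ} (hg : Integrable g ν) :
      IsFiniteMeasure (ν.withDensity fun x => ENNReal.ofReal (g x)) :=
    isFiniteMeasure_withDensity hg.lintegral_lt_top.ne
  have integrable_char {g : ℝ → ℝ} (hg : Integrable g ν) (t : ℝ) :
      Integrable (fun x => ((max (g x) 0 : ℝ) : ℂ) * Complex.exp ((t * x : ℝ) * Complex.I)) ν :=
    (hg.pos_part.ofReal (𝕜 := ℂ)).mul_bdd (c := 1) (by fun_prop)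
      (.of_forall fun x => (Complex.norm_exp_ofReal_mul_I _).le)
  have h_neg : Integrable (fun x => -h x) ν := h_int.neg
  have := isFinite h_int
  have := isFinite h_neg
  have h_pos_eq_neg : (ν.withDensity fun x => ENNReal.ofReal (h x)) =
      ν.withDensity fun x => ENNReal.ofReal (-h x) := by
    refine Measure.ext_of_charFun (funext fun t => ?_)
    rw [charFun_withDensity_ofReal h_int, charFun_withDensity_ofReal h_neg, ← sub_eq_zero,
      ← integral_sub (integrable_char h_int t) (integrable_char h_neg t), ← h_fourier t]
    refine integral_congr_ae (.of_forall fun x => ?_)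
    simp only [← sub_mul, ← Complex.ofReal_sub]
    congr 2
    exact max_zero_sub_max_neg_zero_eq_self (h x)
  filter_upwards [(withDensity_eq_iff h_int.aemeasurable.ennreal_ofReal
    h_neg.aemeasurable.ennreal_ofReal h_int.lintegral_lt_top.ne).1 h_pos_eq_neg] with x hx
  have hx_max := congrArg ENNReal.toReal hx
  simp only [ENNReal.toReal_ofReal'] at hx_max
  rw [Pi.zero_apply, ← max_zero_sub_max_neg_zero_eq_self (h x), hx_max, sub_self]

variable {E : Type*} [NormedAddCommGroup E] [NormedSpace ℝ E]

theorem integrable_pow_smul {h : ℝ → E}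
    (h_int : ∀ c : ℝ, Integrable (fun x => Real.exp (c * |x|) • h x) ν) (n : ℕ) :
    Integrable (fun x => x ^ n • h x) ν := by
  have h_meas : AEStronglyMeasurable h ν := by simpa using (h_int 0).aestronglyMeasurable
  refine ((h_int 1).norm.const_mul (n ! : ℝ)).mono'
    (AEStronglyMeasurable.smul (by fun_prop) h_meas) (.of_forall fun x => ?_)
  have h_pow := Real.pow_div_factorial_le_exp |x| (abs_nonneg x) n
  rw [div_le_iff₀' (by positivity)] at h_pow
  rw [norm_smul, norm_smul, norm_pow, Real.norm_eq_abs, Real.norm_eq_abs, Real.abs_exp, one_mul,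
    ← mul_assoc]
  gcongr

theorem ae_eq_zero_of_moments_eq_zero [SecondCountableTopology E] [CompleteSpace E] {h : ℝ → E}
    (h_int : ∀ c : ℝ, Integrable (fun x => Real.exp (c * |x|) • h x) ν)
    (h_mom : ∀ n : ℕ, ∫ x, x ^ n • h x ∂ν = 0) : h =ᵐ[ν] 0 := by
  refine ae_eq_zero_of_forall_dual ℝ fun L => ?_
  have L_int (c : ℝ) : Integrable (fun x => Real.exp (c * |x|) * L (h x)) ν := by
    simpa using L.integrable_comp (h_int c)
  refine ae_eq_zero_of_integral_ofReal_mul_exp_I_eq_zero (by simpa using L_int 0)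
    (integral_ofReal_mul_exp_I_eq_zero_of_moments L_int fun n => ?_)
  simpa [h_mom] using L.integral_comp_comm (integrable_pow_smul h_int n)

end Moments

namespace BoseLike

section GenExp

variable {μ : ℝ}

/-! ### Generalized factorials and the generalized exponential -/

/-- The quotient `γ_μ(n) / γ_μ(n - 1)`: equivalently, the Dunkl operator
`f'(x) + (μ / x) (f(x) - f(-x))` maps `xⁿ` to `dunklFactor μ n * xⁿ⁻¹`. -/
def dunklFactor (μ : ℝ) (n : ℕ) : ℝ := n + if Odd n then 2 * μ else 0

theorem dunklFactor_zero (μ : ℝ) : dunklFactor μ 0 = 0 := by simp [dunklFactor]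

theorem dunklFactor_succ_pos (hμ : -(1 / 2) < μ) (n : ℕ) : 0 < dunklFactor μ (n + 1) := by
  unfold dunklFactor
  split_ifs <;> push_cast <;> linarith [(n.cast_nonneg : (0 : ℝ) ≤ n)]

theorem half_add_one_le_dunklFactor (hμ : -(1 / 2) < μ) {n : ℕ} (hn : n ≠ 0) :
    ((n + 1 : ℕ) : ℝ) / 2 ≤ dunklFactor μ (n + 1) := by
  have hn1 : (1 : ℝ) ≤ n := by exact_mod_cast Nat.one_le_iff_ne_zero.2 hn
  unfold dunklFactor
  split_ifs with h_odd
  · have hn2 : (2 : ℝ) ≤ n := by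
      have : n ≠ 1 := by rintro rfl; exact absurd h_odd (by decide)
      exact_mod_cast (by lia : 2 ≤ n)
    push_cast
    linarith
  · push_cast
    linarith

theorem Gamma_add_half_pos (hμ : -(1 / 2) < μ) : 0 < Real.Gamma (μ + 1 / 2) :=
  Real.Gamma_pos_of_pos (by linarith)

theorem genFactorial_two_mul (μ : ℝ) (m : ℕ) : genFactorial μ (2 * m) =
    2 ^ (2 * m) * m ! * Real.Gamma (m + μ + 1 / 2) / Real.Gamma (μ + 1 / 2) := by
  rw [genFactorial, show 2 * m / 2 = m by lia, show (2 * m + 1) / 2 = m by lia]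

theorem genFactorial_two_mul_add_one (μ : ℝ) (m : ℕ) : genFactorial μ (2 * m + 1) =
    2 ^ (2 * m + 1) * m ! * Real.Gamma ((m + 1 : ℕ) + μ + 1 / 2) / Real.Gamma (μ + 1 / 2) := by
  rw [genFactorial, show (2 * m + 1) / 2 = m by lia, show (2 * m + 1 + 1) / 2 = m + 1 by lia]

theorem genFactorial_zero (hμ : -(1 / 2) < μ) : genFactorial μ 0 = 1 := by
  simpa using (genFactorial_two_mul μ 0).trans
    (by simpa using div_self (Gamma_add_half_pos hμ).ne')

theorem genFactorial_succ (hμ : -(1 / 2) < μ) (n : ℕ) :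
    genFactorial μ (n + 1) = dunklFactor μ (n + 1) * genFactorial μ n := by
  obtain ⟨m, rfl | rfl⟩ := n.even_or_odd'
  · have hm : (m : ℝ) + μ + 1 / 2 ≠ 0 := by linarith [(m.cast_nonneg : (0 : ℝ) ≤ m)]
    have h_factor : dunklFactor μ (2 * m + 1) = 2 * (m + μ + 1 / 2) := by
      rw [dunklFactor, if_pos (odd_two_mul_add_one m)]
      push_cast
      ring
    rw [genFactorial_two_mul_add_one, genFactorial_two_mul, h_factor, Nat.cast_succ,
      show (m : ℝ) + 1 + μ + 1 / 2 = m + μ + 1 / 2 + 1 by ring, Real.Gamma_add_one hm]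
    ring
  · have h_factor : dunklFactor μ (2 * (m + 1)) = 2 * (m + 1) := by
      rw [dunklFactor, if_neg (Nat.not_odd_iff_even.2 (even_two_mul _))]
      push_cast
      ring
    rw [show 2 * m + 1 + 1 = 2 * (m + 1) by ring, genFactorial_two_mul_add_one,
      genFactorial_two_mul, h_factor, Nat.factorial_succ]
    push_cast
    ring

theorem genFactorial_pos (hμ : -(1 / 2) < μ) (n : ℕ) : 0 < genFactorial μ n := by
  induction n with
  | zero => exact (genFactorial_zero hμ).symm ▸ one_pos
  | succ n ih => exact genFactorial_succ hμ n ▸ mul_pos (dunklFactor_succ_pos hμ n) ih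

theorem dunklFactor_mul_pow_div (hμ : -(1 / 2) < μ) (a : ℝ) (n : ℕ) :
    dunklFactor μ (n + 1) * (a ^ (n + 1) / genFactorial μ (n + 1)) =
      a * (a ^ n / genFactorial μ n) := by
  rw [genFactorial_succ hμ, pow_succ']
  have h_factor := (dunklFactor_succ_pos hμ n).ne'
  field_simp

theorem exists_inv_genFactorial_le (hμ : -(1 / 2) < μ) :
    ∃ C : ℝ, ∀ n, (genFactorial μ n)⁻¹ ≤ C * (2 ^ n / n !) := by
  set C : ℝ := max 1 (dunklFactor μ 1)⁻¹
  refine ⟨C, fun n => ?_⟩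
  induction n with
  | zero => simp [genFactorial_zero hμ, C]
  | succ n ih =>
    rcases eq_or_ne n 0 with rfl | hn
    · have hC : (dunklFactor μ 1)⁻¹ ≤ C := le_max_right ..
      have hC_pos : 0 < C := one_pos.trans_le (le_max_left ..)
      rw [genFactorial_succ hμ, genFactorial_zero hμ]
      norm_num
      linarith
    · have h_half := half_add_one_le_dunklFactor hμ hn
      have h_pos := genFactorial_pos hμ n
      calc (genFactorial μ (n + 1))⁻¹
          = (dunklFactor μ (n + 1))⁻¹ * (genFactorial μ n)⁻¹ := by
            rw [genFactorial_succ hμ, mul_inv]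
        _ ≤ (((n + 1 : ℕ) : ℝ) / 2)⁻¹ * (C * (2 ^ n / n !)) := by gcongr
        _ = C * (2 ^ (n + 1) / (n + 1)!) := by
            rw [Nat.factorial_succ]
            push_cast
            field_simp
            ring

theorem norm_pow_div_genFactorial_le (hμ : -(1 / 2) < μ) {C : ℝ}
    (hC : ∀ n, (genFactorial μ n)⁻¹ ≤ C * (2 ^ n / n !)) (z : ℂ) (n : ℕ) :
    ‖z ^ n / (genFactorial μ n : ℂ)‖ ≤ C * ((2 * ‖z‖) ^ n / n !) := by
  rw [norm_div, norm_pow, Complex.norm_real, Real.norm_of_nonneg (genFactorial_pos hμ n).le]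
  calc ‖z‖ ^ n / genFactorial μ n ≤ ‖z‖ ^ n * (C * (2 ^ n / n !)) :=
        mul_le_mul_of_nonneg_left (hC n) (by positivity)
    _ = C * ((2 * ‖z‖) ^ n / n !) := by ring

theorem summable_norm_pow_div_genFactorial (hμ : -(1 / 2) < μ) (z : ℂ) :
    Summable fun n => ‖z ^ n / (genFactorial μ n : ℂ)‖ := by
  obtain ⟨C, hC⟩ := exists_inv_genFactorial_le hμ
  exact .of_nonneg_of_le (fun _ => norm_nonneg _) (norm_pow_div_genFactorial_le hμ hC z)
    ((Real.summable_pow_div_factorial _).mul_left C)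

theorem hasSum_genExp (hμ : -(1 / 2) < μ) (z : ℂ) :
    HasSum (fun n => z ^ n / (genFactorial μ n : ℂ)) (genExp μ z) :=
  (summable_norm_pow_div_genFactorial hμ z).of_norm.hasSum

theorem exists_tsum_norm_pow_div_genFactorial_le (hμ : -(1 / 2) < μ) :
    ∃ C : ℝ, ∀ z : ℂ, ∑' n, ‖z ^ n / (genFactorial μ n : ℂ)‖ ≤ C * Real.exp (2 * ‖z‖) := by
  obtain ⟨C, hC⟩ := exists_inv_genFactorial_le hμ
  refine ⟨C, fun z => ?_⟩
  rw [Real.exp_eq_exp_ℝ]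
  exact hasSum_le (norm_pow_div_genFactorial_le hμ hC z)
    (summable_norm_pow_div_genFactorial hμ z).hasSum
    ((NormedSpace.expSeries_div_hasSum_exp (2 * ‖z‖)).mul_left C)

theorem exists_norm_genExp_le (hμ : -(1 / 2) < μ) :
    ∃ C : ℝ, ∀ z, ‖genExp μ z‖ ≤ C * Real.exp (2 * ‖z‖) := by
  obtain ⟨C, hC⟩ := exists_tsum_norm_pow_div_genFactorial_le hμ
  exact ⟨C, fun z => (norm_tsum_le_tsum_norm (summable_norm_pow_div_genFactorial hμ z)).trans
    (hC z)⟩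

theorem measurable_genExp (hμ : -(1 / 2) < μ) : Measurable (genExp μ) := by
  refine measurable_of_tendsto_metrizable
    (f := fun n z => ∑ i ∈ Finset.range n, z ^ i / (genFactorial μ i : ℂ)) (fun n => by fun_prop) ?_
  rw [tendsto_pi_nhds]
  exact fun z => (hasSum_genExp hμ z).tendsto_sum_nat

theorem conj_genExp (μ : ℝ) (z : ℂ) :
    (starRingEnd ℂ) (genExp μ z) = genExp μ ((starRingEnd ℂ) z) := by
  simp only [genExp, Complex.conj_tsum, map_div₀, map_pow, Complex.conj_ofReal]

/-! ### The generating function of the generalized Hermite polynomials -/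

/-- The formal power series `exp (c X²)`. -/
def gaussSeries (c : ℝ) : PowerSeries ℝ :=
  PowerSeries.expand 2 two_ne_zero (PowerSeries.rescale c (PowerSeries.exp ℝ))

theorem coeff_gaussSeries_two_mul (c : ℝ) (k : ℕ) :
    (gaussSeries c).coeff (2 * k) = c ^ k / k ! := by
  rw [gaussSeries, PowerSeries.coeff_expand_mul, PowerSeries.coeff_rescale, PowerSeries.coeff_exp,
    eq_ratCast, Rat.cast_div, Rat.cast_one, Rat.cast_natCast, mul_one_div]

theorem coeff_gaussSeries_of_odd (c : ℝ) {n : ℕ} (hn : Odd n) : (gaussSeries c).coeff n = 0 :=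
  PowerSeries.coeff_expand_of_not_dvd 2 two_ne_zero _ hn.not_two_dvd_nat

theorem gaussSeries_zero : gaussSeries 0 = 1 := by
  simp [gaussSeries]

theorem gaussSeries_mul (c d : ℝ) : gaussSeries c * gaussSeries d = gaussSeries (c + d) := by
  rw [gaussSeries, gaussSeries, ← map_mul, PowerSeries.exp_mul_exp_eq_exp_add, gaussSeries]

theorem derivative_gaussSeries (c : ℝ) : PowerSeries.derivative ℝ (gaussSeries c) =
    .X * (.C (2 * c) * gaussSeries c) := by
  ext n
  rw [PowerSeries.coeff_derivative]
  obtain ⟨k, rfl | rfl⟩ := n.even_or_odd'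
  · rw [coeff_gaussSeries_of_odd c (odd_two_mul_add_one k), zero_mul]
    cases k with
    | zero => simp
    | succ k =>
      rw [show 2 * (k + 1) = 2 * k + 1 + 1 by ring, PowerSeries.coeff_succ_X_mul,
        PowerSeries.coeff_C_mul, coeff_gaussSeries_of_odd c (odd_two_mul_add_one k), mul_zero]
  · rw [PowerSeries.coeff_succ_X_mul, PowerSeries.coeff_C_mul, coeff_gaussSeries_two_mul,
      show 2 * k + 1 + 1 = 2 * (k + 1) by ring, coeff_gaussSeries_two_mul, Nat.factorial_succ]
    push_cast
    field_simp
    ring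

theorem evalNegHom_gaussSeries (c : ℝ) :
    PowerSeries.evalNegHom (gaussSeries c) = gaussSeries c := by
  ext n
  rw [PowerSeries.evalNegHom, PowerSeries.coeff_rescale]
  rcases n.even_or_odd with hn | hn
  · rw [hn.neg_one_pow, one_mul]
  · rw [coeff_gaussSeries_of_odd c hn, mul_zero]

theorem hasSum_gaussSeries (c : ℝ) (z : ℂ) :
    HasSum (fun n => ((gaussSeries c).coeff n : ℂ) * z ^ n) (Complex.exp (c * z ^ 2)) := by
  rw [← (mul_right_injective₀ (two_ne_zero' ℕ)).hasSum_iff fun n hn => ?_]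
  · rw [Complex.exp_eq_exp_ℂ]
    convert! NormedSpace.expSeries_div_hasSum_exp ((c : ℂ) * z ^ 2) using 2 with k
    rw [Function.comp_apply, coeff_gaussSeries_two_mul, mul_pow, ← pow_mul]
    push_cast
    ring
  · have hn_odd : Odd n := Nat.not_even_iff_odd.1 fun h =>
      hn ⟨n / 2, Nat.two_mul_div_two_of_even h⟩
    rw [coeff_gaussSeries_of_odd _ hn_odd, Complex.ofReal_zero, zero_mul]

/-- The formal power series of `z ↦ e_μ(a z)`. -/
def genExpSeries (μ a : ℝ) : PowerSeries ℝ :=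
  .mk fun n => a ^ n / genFactorial μ n

/-- `X` times the Dunkl operator `d/dX + (μ / X) (1 - s)`, where `s` is the substitution of `-X`
for `X`. -/
def eulerDunkl (μ : ℝ) (f : PowerSeries ℝ) : PowerSeries ℝ :=
  .X * .derivative ℝ f + .C μ * (f - .evalNegHom f)

theorem coeff_eulerDunkl (μ : ℝ) (f : PowerSeries ℝ) (n : ℕ) :
    (eulerDunkl μ f).coeff n = dunklFactor μ n * f.coeff n := by
  have h_neg : (f - .evalNegHom f).coeff n = if Odd n then 2 * f.coeff n else 0 := by
    rw [map_sub, PowerSeries.evalNegHom, PowerSeries.coeff_rescale]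
    split_ifs with hn
    · rw [hn.neg_one_pow]; ring
    · rw [(Nat.not_odd_iff_even.1 hn).neg_one_pow]; ring
  have h_deriv : (.X * .derivative ℝ f : PowerSeries ℝ).coeff n = n * f.coeff n := by
    cases n with
    | zero => simp
    | succ n => rw [PowerSeries.coeff_succ_X_mul, PowerSeries.coeff_derivative]; push_cast; ring
  rw [eulerDunkl, map_add, PowerSeries.coeff_C_mul, h_neg, h_deriv, dunklFactor]
  split_ifs <;> ring

theorem eulerDunkl_mul {f : PowerSeries ℝ} (hf : PowerSeries.evalNegHom f = f)
    (g : PowerSeries ℝ) :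
    eulerDunkl μ (f * g) = .X * .derivative ℝ f * g + f * eulerDunkl μ g := by
  rw [eulerDunkl, eulerDunkl, map_mul PowerSeries.evalNegHom, hf, Derivation.leibniz,
    smul_eq_mul, smul_eq_mul]
  ring

theorem eulerDunkl_genExpSeries (hμ : -(1 / 2) < μ) (a : ℝ) :
    eulerDunkl μ (genExpSeries μ a) = .X * (.C a * genExpSeries μ a) := by
  ext n
  rw [coeff_eulerDunkl]
  cases n with
  | zero => simp [dunklFactor_zero]
  | succ n =>
    rw [PowerSeries.coeff_succ_X_mul, PowerSeries.coeff_C_mul, genExpSeries, PowerSeries.coeff_mk,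
      PowerSeries.coeff_mk, dunklFactor_mul_pow_div hμ]

/-- The formal power series of `z ↦ exp (-z²) e_μ(2 x z)`, the generating function of the
polynomials `genHermite μ n / n!`. -/
def hermiteSeries (μ x : ℝ) : PowerSeries ℝ :=
  gaussSeries (-1) * genExpSeries μ (2 * x)

theorem dunklFactor_mul_coeff_hermiteSeries (hμ : -(1 / 2) < μ) (n : ℕ) (x : ℝ) :
    dunklFactor μ (n + 1) * (hermiteSeries μ x).coeff (n + 1) =
      2 * x * (hermiteSeries μ x).coeff n -
        2 * (.X * hermiteSeries μ x : PowerSeries ℝ).coeff n := by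
  have h_series : eulerDunkl μ (hermiteSeries μ x) =
      .X * (.C (2 * x) * hermiteSeries μ x - .C 2 * (.X * hermiteSeries μ x)) := by
    rw [hermiteSeries, eulerDunkl_mul (evalNegHom_gaussSeries _), eulerDunkl_genExpSeries hμ,
      derivative_gaussSeries, mul_neg_one, map_neg]
    ring
  rw [← coeff_eulerDunkl, h_series, PowerSeries.coeff_succ_X_mul, map_sub, PowerSeries.coeff_C_mul,
    PowerSeries.coeff_C_mul]

theorem coeff_hermiteSeries_zero (hμ : -(1 / 2) < μ) (x : ℝ) :
    (hermiteSeries μ x).coeff 0 = 1 := by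
  have h_gauss := coeff_gaussSeries_two_mul (-1) 0
  simp only [mul_zero, pow_zero, Nat.factorial_zero, Nat.cast_one, div_one] at h_gauss
  simp [hermiteSeries, PowerSeries.coeff_mul, h_gauss, genExpSeries, genFactorial_zero hμ]

theorem coeff_hermiteSeries (μ : ℝ) (n : ℕ) (x : ℝ) : (hermiteSeries μ x).coeff n =
    ∑ p ∈ Finset.HasAntidiagonal.antidiagonal n,
      (gaussSeries (-1)).coeff p.1 * ((2 * x) ^ p.2 / genFactorial μ p.2) := by
  simp only [hermiteSeries, PowerSeries.coeff_mul, genExpSeries, PowerSeries.coeff_mk]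

theorem genHermite_eq (μ : ℝ) (n : ℕ) (x : ℝ) :
    genHermite μ n x = n ! * (hermiteSeries μ x).coeff n := by
  rw [genHermite, coeff_hermiteSeries, Finset.Nat.sum_antidiagonal_eq_sum_range_succ_mk]
  congr 1
  refine Finset.sum_of_injOn (2 * ·) (mul_right_injective₀ two_ne_zero).injOn (fun k hk => ?_)
    (fun k hkn hk => ?_) fun k _ => ?_
  · simp only [Finset.coe_range, Set.mem_Iio] at hk ⊢
    lia
  · have hk_odd : Odd k := Nat.not_even_iff_odd.1 fun h =>
      hk ⟨k / 2, by grind, Nat.two_mul_div_two_of_even h⟩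
    rw [coeff_gaussSeries_of_odd _ hk_odd, zero_mul]
  · rw [coeff_gaussSeries_two_mul]
    ring

theorem hasSum_hermiteSeries (hμ : -(1 / 2) < μ) (z : ℂ) (x : ℝ) :
    HasSum (fun n => ((hermiteSeries μ x).coeff n : ℂ) * z ^ n)
      (Complex.exp (-z ^ 2) * genExp μ (2 * x * z)) := by
  have h_gauss := (hasSum_gaussSeries (-1) z).summable.norm
  have h_genExp := summable_norm_pow_div_genFactorial hμ (2 * x * z)
  have h_sum :=
    (summable_norm_sum_mul_antidiagonal_of_summable_norm h_gauss h_genExp).of_norm.hasSum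
  rw [← tsum_mul_tsum_eq_tsum_sum_antidiagonal_of_summable_norm h_gauss h_genExp,
    (hasSum_gaussSeries (-1) z).tsum_eq, (hasSum_genExp hμ _).tsum_eq] at h_sum
  convert! h_sum using 2 with n
  · rw [coeff_hermiteSeries]
    push_cast
    rw [Finset.sum_mul]
    refine Finset.sum_congr rfl fun p hp => ?_
    rw [← Finset.HasAntidiagonal.mem_antidiagonal.1 hp, pow_add, mul_pow _ z]
    ring
  · simp

end GenExp

section Hermite

variable {μ : ℝ}

/-! ### Integration against the weight -/

theorem weightMeasure_absolutelyContinuous_volume (μ : ℝ) : weightMeasure μ ≪ volume :=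
  withDensity_absolutelyContinuous _ _

theorem ae_weightMeasure_ne_zero (μ : ℝ) : ∀ᵐ x ∂(weightMeasure μ), x ≠ 0 :=
  (weightMeasure_absolutelyContinuous_volume μ).ae_le (volume.ae_ne 0)

section Integral

variable {E : Type*} [NormedAddCommGroup E] [NormedSpace ℝ E]

theorem integrable_weightMeasure_iff (μ : ℝ) (f : ℝ → E) :
    Integrable f (weightMeasure μ) ↔ Integrable fun x : ℝ => |x| ^ (2 * μ) • f x := by
  rw [weightMeasure, integrable_withDensity_iff_integrable_smul' (by fun_prop)
    (Eventually.of_forall fun x => ENNReal.ofReal_lt_top)]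
  simp only [ENNReal.toReal_ofReal (Real.rpow_nonneg (abs_nonneg _) _)]

theorem integral_weightMeasure (μ : ℝ) (f : ℝ → E) :
    ∫ x, f x ∂(weightMeasure μ) = ∫ x : ℝ, |x| ^ (2 * μ) • f x := by
  rw [weightMeasure, integral_withDensity_eq_integral_toReal_smul (by fun_prop)
    (Eventually.of_forall fun x => ENNReal.ofReal_lt_top)]
  simp only [ENNReal.toReal_ofReal (Real.rpow_nonneg (abs_nonneg _) _)]

theorem integral_weightMeasure_comp_mul (μ : ℝ) (f : ℝ → E) {c : ℝ} (hc : 0 < c) :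
    ∫ x, f (c * x) ∂(weightMeasure μ) = (c ^ (2 * μ + 1))⁻¹ • ∫ x, f x ∂(weightMeasure μ) := by
  have h_weight (x : ℝ) :
      |x| ^ (2 * μ) • f (c * x) = (c ^ (2 * μ))⁻¹ • (|c * x| ^ (2 * μ) • f (c * x)) := by
    rw [abs_mul, abs_of_pos hc, Real.mul_rpow hc.le (abs_nonneg x), smul_smul, ← mul_assoc,
      inv_mul_cancel₀ (by positivity), one_mul]
  simp only [integral_weightMeasure, h_weight]
  rw [integral_smul, Measure.integral_comp_mul_left (fun y : ℝ => |y| ^ (2 * μ) • f y), smul_smul,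
    abs_of_pos (inv_pos.2 hc), Real.rpow_add hc, Real.rpow_one, mul_inv]

theorem integral_weightMeasure_of_odd (μ : ℝ) {f : ℝ → E} (hf : f.Odd) :
    ∫ x, f x ∂(weightMeasure μ) = 0 := by
  rw [integral_weightMeasure]
  have h_neg := integral_neg_eq_self (fun x : ℝ => |x| ^ (2 * μ) • f x) volume
  simp only [abs_neg, hf _, smul_neg, integral_neg] at h_neg
  have := IsAddTorsionFree.of_isTorsionFree ℝ E
  exact self_eq_neg.1 h_neg.symm

end Integral

section Decay

variable {E : Type*} [NormedAddCommGroup E] {s : ℝ} {f : ℝ → E}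

theorem integrable_exp_neg_mul_sq_weightMeasure (hμ : -(1 / 2) < μ) (hs : 0 < s) :
    Integrable (fun x : ℝ => Real.exp (-s * x ^ 2)) (weightMeasure μ) := by
  have h_integral : ∫ x : ℝ, |x| ^ (2 * μ) • Real.exp (-s * x ^ 2) =
      2 * ∫ x in Set.Ioi (0 : ℝ), x ^ (2 * μ) * Real.exp (-s * x ^ (2 : ℝ)) := by
    rw [← integral_comp_abs]
    simp only [smul_eq_mul, Real.rpow_two, sq_abs]
  rw [integrable_weightMeasure_iff]
  refine .of_integral_ne_zero (h_integral.trans_ne ?_)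
  rw [integral_rpow_mul_exp_neg_mul_rpow two_pos (by linarith) hs]
  have h_Gamma := Real.Gamma_pos_of_pos (show 0 < (2 * μ + 1) / 2 by linarith)
  positivity

theorem integrable_exp_mul_abs_sub_mul_sq (hμ : -(1 / 2) < μ) (hs : 0 < s) (c : ℝ) :
    Integrable (fun x : ℝ => Real.exp (c * |x| - s * x ^ 2)) (weightMeasure μ) := by
  refine ((integrable_exp_neg_mul_sq_weightMeasure hμ (half_pos hs)).const_mul
    (Real.exp (c ^ 2 / (2 * s)))).mono' (by fun_prop) (Eventually.of_forall fun x => ?_)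
  rw [Real.norm_of_nonneg (Real.exp_pos _).le, ← Real.exp_add, Real.exp_le_exp]
  have h_square : c ^ 2 / (2 * s) + -(s / 2) * x ^ 2 - (c * |x| - s * x ^ 2) =
      (s * |x| - c) ^ 2 / (2 * s) := by
    rw [← sq_abs x]
    field_simp
    ring
  have : 0 ≤ (s * |x| - c) ^ 2 / (2 * s) := by positivity
  linarith

theorem integrable_of_norm_le_exp (hμ : -(1 / 2) < μ) (hs : 0 < s) {C c : ℝ}
    (hf : AEStronglyMeasurable f (weightMeasure μ))
    (h_le : ∀ x, ‖f x‖ ≤ C * Real.exp (c * |x| - s * x ^ 2)) : Integrable f (weightMeasure μ) :=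
  ((integrable_exp_mul_abs_sub_mul_sq hμ hs c).const_mul C).mono' hf (Eventually.of_forall h_le)

theorem memLp_two_of_norm_le_exp (hμ : -(1 / 2) < μ) (hs : 0 < s) {C c : ℝ}
    (hf : AEStronglyMeasurable f (weightMeasure μ))
    (h_le : ∀ x, ‖f x‖ ≤ C * Real.exp (c * |x| - s * x ^ 2)) : MemLp f 2 (weightMeasure μ) := by
  rw [memLp_two_iff_integrable_sq_norm hf]
  refine integrable_of_norm_le_exp hμ (s := 2 * s) (by positivity) (C := C ^ 2) (c := 2 * c)
    (hf.norm.pow 2) fun x => ?_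
  rw [Real.norm_of_nonneg (by positivity)]
  calc ‖f x‖ ^ 2 ≤ (C * Real.exp (c * |x| - s * x ^ 2)) ^ 2 := by gcongr; exact h_le x
    _ = C ^ 2 * Real.exp (2 * c * |x| - 2 * s * x ^ 2) := by
      rw [mul_pow, ← Real.exp_nat_mul]
      push_cast
      ring_nf

end Decay

theorem integral_even_pow_mul_exp_neg_sq (hμ : -(1 / 2) < μ) (k : ℕ) :
    ∫ x : ℝ, x ^ (2 * k) * Real.exp (-x ^ 2) ∂(weightMeasure μ) = Real.Gamma (k + μ + 1 / 2) := by
  have h_abs := integral_comp_abs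
    (f := fun x : ℝ => x ^ (2 * μ) * (x ^ (2 * k) * Real.exp (-x ^ 2)))
  have h_Gamma := integral_rpow_mul_exp_neg_rpow (p := 2) (q := 2 * μ + 2 * k) (by norm_num)
    (by linarith [(k.cast_nonneg : (0 : ℝ) ≤ k)])
  have h_half_line : ∫ x in Set.Ioi (0 : ℝ), x ^ (2 * μ) * (x ^ (2 * k) * Real.exp (-x ^ 2)) =
      ∫ x in Set.Ioi (0 : ℝ), x ^ (2 * μ + 2 * k) * Real.exp (-x ^ (2 : ℝ)) := by
    refine setIntegral_congr_fun measurableSet_Ioi fun x hx => ?_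
    rw [Real.rpow_add hx, Real.rpow_two, mul_assoc, ← Real.rpow_natCast x (2 * k)]
    push_cast
    rfl
  simp only [sq_abs, (even_two_mul k).pow_abs] at h_abs
  simp only [integral_weightMeasure, smul_eq_mul]
  rw [h_abs, h_half_line, h_Gamma, show (2 * μ + 2 * k + 1) / 2 = k + μ + 1 / 2 by ring]
  ring

theorem integral_pow_div_genFactorial_mul_exp_neg_sq (hμ : -(1 / 2) < μ) (n : ℕ) :
    ∫ x : ℝ, (2 * x) ^ n / genFactorial μ n * Real.exp (-x ^ 2) ∂(weightMeasure μ) =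
      Real.Gamma (μ + 1 / 2) * (gaussSeries 1).coeff n := by
  obtain ⟨k, rfl | rfl⟩ := n.even_or_odd'
  · have h_Gamma : 0 < Real.Gamma (k + μ + 1 / 2) :=
      Real.Gamma_pos_of_pos (by linarith [(k.cast_nonneg : (0 : ℝ) ≤ k)])
    have h_Gamma₀ := Gamma_add_half_pos hμ
    have h_monomial (x : ℝ) : (2 * x) ^ (2 * k) / genFactorial μ (2 * k) * Real.exp (-x ^ 2) =
        2 ^ (2 * k) / genFactorial μ (2 * k) * (x ^ (2 * k) * Real.exp (-x ^ 2)) := by ring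
    simp only [h_monomial]
    rw [integral_const_mul, integral_even_pow_mul_exp_neg_sq hμ, coeff_gaussSeries_two_mul,
      genFactorial_two_mul, one_pow]
    generalize Real.Gamma (k + μ + 1 / 2) = Γk at h_Gamma ⊢
    generalize Real.Gamma (μ + 1 / 2) = Γ0 at h_Gamma₀ ⊢
    field_simp
  · rw [coeff_gaussSeries_of_odd _ (odd_two_mul_add_one k), mul_zero]
    refine integral_weightMeasure_of_odd μ fun x => ?_
    rw [neg_sq, mul_neg, (odd_two_mul_add_one k).neg_pow]
    ring

/-! ### The Hermite functions -/

/-- The factor that normalizes `exp (-x²/2)` times the coefficients of `hermiteSeries μ x`. -/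
def hermiteScale (μ : ℝ) (n : ℕ) : ℝ :=
  √(genFactorial μ n / (2 ^ n * Real.Gamma (μ + 1 / 2)))

/-- The generalized Hermite functions `hermiteFun μ n`, which are real, as real functions. -/
def realHermiteFun (μ : ℝ) (n : ℕ) (x : ℝ) : ℝ :=
  hermiteScale μ n * (Real.exp (-x ^ 2 / 2) * (hermiteSeries μ x).coeff n)

/-- The coefficients of the position and momentum operators in the basis of Hermite functions, as
in `mul_realHermiteFun` and `dunkl_realHermiteFun`. -/
def ladderCoeff (μ : ℝ) (n : ℕ) : ℝ :=
  √(dunklFactor μ n / 2)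

theorem hermiteFun_eq (μ : ℝ) (n : ℕ) (x : ℝ) : hermiteFun μ n x = realHermiteFun μ n x := by
  have h_scale : hermiteScale μ n =
      √(genFactorial μ n / Real.Gamma (μ + 1 / 2)) / 2 ^ ((n : ℝ) / 2) := by
    rw [hermiteScale, mul_comm, ← div_div, Real.sqrt_div' _ (by positivity),
      Real.sqrt_eq_rpow (2 ^ n), ← Real.rpow_natCast_mul two_pos.le, mul_one_div]
  rw [hermiteFun, realHermiteFun, genHermite_eq, h_scale]
  congr 1
  field_simp

theorem hermiteScale_pos (hμ : -(1 / 2) < μ) (n : ℕ) : 0 < hermiteScale μ n :=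
  Real.sqrt_pos.2 (div_pos (genFactorial_pos hμ n)
    (mul_pos (by positivity) (Gamma_add_half_pos hμ)))

theorem hermiteScale_succ (hμ : -(1 / 2) < μ) (n : ℕ) :
    hermiteScale μ (n + 1) = ladderCoeff μ (n + 1) * hermiteScale μ n := by
  rw [hermiteScale, genFactorial_succ hμ, ladderCoeff, hermiteScale,
    ← Real.sqrt_mul (half_pos (dunklFactor_succ_pos hμ n)).le]
  congr 1
  ring

theorem ladderCoeff_zero (μ : ℝ) : ladderCoeff μ 0 = 0 := by
  simp [ladderCoeff, dunklFactor_zero]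

theorem ladderCoeff_succ_pos (hμ : -(1 / 2) < μ) (n : ℕ) : 0 < ladderCoeff μ (n + 1) :=
  Real.sqrt_pos.2 (half_pos (dunklFactor_succ_pos hμ n))

theorem ladderCoeff_succ_mul_realHermiteFun (hμ : -(1 / 2) < μ) (n : ℕ) (x : ℝ) :
    ladderCoeff μ (n + 1) * realHermiteFun μ (n + 1) x = hermiteScale μ n * (Real.exp (-x ^ 2 / 2) *
      (dunklFactor μ (n + 1) / 2 * (hermiteSeries μ x).coeff (n + 1))) := by
  have h_sq := Real.mul_self_sqrt (half_pos (dunklFactor_succ_pos hμ n)).le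
  rw [realHermiteFun, hermiteScale_succ hμ, ← h_sq, ladderCoeff]
  ring

theorem ladderCoeff_mul_realHermiteFun_pred (hμ : -(1 / 2) < μ) (n : ℕ) (x : ℝ) :
    ladderCoeff μ n * realHermiteFun μ (n - 1) x = hermiteScale μ n *
      (Real.exp (-x ^ 2 / 2) * (.X * hermiteSeries μ x : PowerSeries ℝ).coeff n) := by
  cases n with
  | zero => simp [ladderCoeff_zero]
  | succ n =>
    rw [Nat.add_sub_cancel, realHermiteFun, PowerSeries.coeff_succ_X_mul, hermiteScale_succ hμ]
    ring

theorem mul_realHermiteFun (hμ : -(1 / 2) < μ) (n : ℕ) (x : ℝ) :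
    x * realHermiteFun μ n x =
      ladderCoeff μ (n + 1) * realHermiteFun μ (n + 1) x +
        ladderCoeff μ n * realHermiteFun μ (n - 1) x := by
  rw [ladderCoeff_succ_mul_realHermiteFun hμ, ladderCoeff_mul_realHermiteFun_pred hμ,
    realHermiteFun]
  linear_combination (-(hermiteScale μ n * Real.exp (-x ^ 2 / 2)) / 2) *
    dunklFactor_mul_coeff_hermiteSeries hμ n x

theorem continuous_coeff_hermiteSeries (μ : ℝ) (n : ℕ) :
    Continuous fun x => (hermiteSeries μ x).coeff n := by
  simp only [coeff_hermiteSeries]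
  fun_prop

theorem continuous_realHermiteFun (μ : ℝ) (n : ℕ) : Continuous (realHermiteFun μ n) := by
  have := continuous_coeff_hermiteSeries μ n
  unfold realHermiteFun
  fun_prop

theorem abs_two_mul_pow_le (x : ℝ) (n : ℕ) : |(2 * x) ^ n| ≤ n ! * Real.exp (2 * |x|) := by
  have h_exp := Real.pow_div_factorial_le_exp (2 * |x|) (by positivity) n
  rw [abs_pow, abs_mul, abs_two]
  rwa [div_le_iff₀' (by positivity)] at h_exp

theorem exists_abs_realHermiteFun_le (μ : ℝ) (n : ℕ) :
    ∃ C : ℝ, ∀ x, |realHermiteFun μ n x| ≤ C * Real.exp (2 * |x| - 1 / 2 * x ^ 2) := by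
  set C : ℝ := ∑ p ∈ Finset.HasAntidiagonal.antidiagonal n,
    |(gaussSeries (-1)).coeff p.1| * (p.2 ! / |genFactorial μ p.2|)
  have h_coeff (x : ℝ) : |(hermiteSeries μ x).coeff n| ≤ C * Real.exp (2 * |x|) := by
    rw [coeff_hermiteSeries, Finset.sum_mul]
    refine (Finset.abs_sum_le_sum_abs _ _).trans (Finset.sum_le_sum fun p _ => ?_)
    rw [abs_mul, abs_div, mul_assoc, div_mul_eq_mul_div]
    gcongr
    exact abs_two_mul_pow_le x p.2
  refine ⟨|hermiteScale μ n| * C, fun x => ?_⟩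
  rw [realHermiteFun, abs_mul, abs_mul, abs_of_pos (Real.exp_pos _), mul_assoc]
  refine mul_le_mul_of_nonneg_left
    ((mul_le_mul_of_nonneg_left (h_coeff x) (Real.exp_pos _).le).trans_eq ?_) (abs_nonneg _)
  rw [mul_left_comm, ← Real.exp_add]
  ring_nf

theorem memLp_realHermiteFun (hμ : -(1 / 2) < μ) (n : ℕ) :
    MemLp (realHermiteFun μ n) 2 (weightMeasure μ) := by
  obtain ⟨C, hC⟩ := exists_abs_realHermiteFun_le μ n
  exact memLp_two_of_norm_le_exp hμ one_half_pos
    (continuous_realHermiteFun μ n).aestronglyMeasurable hC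

/-! ### Orthonormality -/

theorem eq_ite_of_three_term {a : ℕ → ℝ} {B : ℕ → ℕ → ℝ} (ha_zero : a 0 = 0)
    (ha : ∀ n, a (n + 1) ≠ 0) (hB_zero : ∀ n, B 0 n = if n = 0 then 1 else 0)
    (hB : ∀ m n, a (m + 1) * B (m + 1) n + a m * B (m - 1) n =
      a (n + 1) * B m (n + 1) + a n * B m (n - 1)) (m n : ℕ) :
    B m n = if m = n then 1 else 0 := by
  induction m using Nat.strong_induction_on generalizing n with
  | _ m ih =>
    cases m with
    | zero => simp only [hB_zero, eq_comm]
    | succ m =>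
      refine mul_left_cancel₀ (ha m) ?_
      have h_prev : a m * B (m - 1) n = if m = n + 1 then a m else 0 := by
        cases m with
        | zero => simp [ha_zero]
        | succ m => rw [Nat.add_sub_cancel, ih m (by lia)]; simp
      have h_next : a n * B m (n - 1) = if m + 1 = n then a n else 0 := by
        cases n with
        | zero => simp [ha_zero]
        | succ n => rw [Nat.add_sub_cancel, ih m (by lia)]; simp
      have h := hB m n
      rw [h_prev, h_next, ih m (by lia) (n + 1)] at h
      rw [mul_ite, mul_one, mul_zero]
      split_ifs at h ⊢ <;> simp_all

theorem integral_realHermiteFun_zero_mul (hμ : -(1 / 2) < μ) (n : ℕ) :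
    ∫ x, realHermiteFun μ 0 x * realHermiteFun μ n x ∂(weightMeasure μ) =
      if n = 0 then 1 else 0 := by
  have h_expand (x : ℝ) : realHermiteFun μ 0 x * realHermiteFun μ n x =
      hermiteScale μ 0 * hermiteScale μ n * ∑ p ∈ Finset.HasAntidiagonal.antidiagonal n,
        (gaussSeries (-1)).coeff p.1 *
          ((2 * x) ^ p.2 / genFactorial μ p.2 * Real.exp (-x ^ 2)) := by
    have h_exp : Real.exp (-x ^ 2) = Real.exp (-x ^ 2 / 2) * Real.exp (-x ^ 2 / 2) := by
      rw [← Real.exp_add]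
      ring_nf
    simp only [realHermiteFun, coeff_hermiteSeries_zero hμ, coeff_hermiteSeries, h_exp,
      ← mul_assoc, ← Finset.sum_mul]
    ring
  have h_integrable (m : ℕ) : Integrable
      (fun x : ℝ => (2 * x) ^ m / genFactorial μ m * Real.exp (-x ^ 2)) (weightMeasure μ) := by
    refine integrable_of_norm_le_exp hμ one_pos (C := m ! / |genFactorial μ m|) (c := 2)
      (by fun_prop) fun x => ?_
    rw [norm_mul, norm_div, Real.norm_eq_abs, Real.norm_eq_abs,
      Real.norm_of_nonneg (Real.exp_pos _).le, sub_eq_add_neg, Real.exp_add, one_mul, ← mul_assoc,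
      div_mul_eq_mul_div (m ! : ℝ)]
    gcongr
    exact abs_two_mul_pow_le x m
  simp only [h_expand]
  rw [integral_const_mul, integral_finsetSum _ fun p _ => (h_integrable p.2).const_mul _]
  simp only [integral_const_mul, integral_pow_div_genFactorial_mul_exp_neg_sq hμ,
    mul_left_comm _ (Real.Gamma _)]
  rw [← Finset.mul_sum, ← PowerSeries.coeff_mul, gaussSeries_mul, neg_add_cancel, gaussSeries_zero,
    PowerSeries.coeff_one]
  split_ifs with hn
  · have h_Gamma := Gamma_add_half_pos hμ
    rw [hn, hermiteScale, genFactorial_zero hμ, Real.mul_self_sqrt (by positivity), pow_zero,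
      one_mul, mul_one, one_div, inv_mul_cancel₀ h_Gamma.ne']
  · simp only [mul_zero]

theorem integral_realHermiteFun_mul (hμ : -(1 / 2) < μ) (m n : ℕ) :
    ∫ x, realHermiteFun μ m x * realHermiteFun μ n x ∂(weightMeasure μ) =
      if m = n then 1 else 0 := by
  have h_integrable (m n : ℕ) :
      Integrable (fun x => realHermiteFun μ m x * realHermiteFun μ n x) (weightMeasure μ) :=
    (memLp_realHermiteFun hμ m).integrable_mul (memLp_realHermiteFun hμ n)
  refine eq_ite_of_three_term
    (B := fun m n => ∫ x, realHermiteFun μ m x * realHermiteFun μ n x ∂(weightMeasure μ))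
    (ladderCoeff_zero μ) (fun n => (ladderCoeff_succ_pos hμ n).ne')
    (integral_realHermiteFun_zero_mul hμ) (fun m n => ?_) m n
  simp only [← integral_const_mul]
  rw [← integral_add ((h_integrable _ _).const_mul _) ((h_integrable _ _).const_mul _),
    ← integral_add ((h_integrable _ _).const_mul _) ((h_integrable _ _).const_mul _)]
  congr 1 with x
  linear_combination realHermiteFun μ m x * mul_realHermiteFun hμ n x -
    realHermiteFun μ n x * mul_realHermiteFun hμ m x

/-! ### The Dunkl operator on the Hermite functions -/

/-- The Dunkl operator `f'(x) + (μ / x) (f(x) - f(-x))`, so that `momentumExpr μ = -i dunkl μ`. It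
is meaningful only for `x ≠ 0`. -/
def dunkl (μ : ℝ) (f : ℝ → ℝ) (x : ℝ) : ℝ :=
  deriv f x + μ / x * (f x - f (-x))

theorem momentumExpr_ofReal {f : ℝ → ℝ} {x : ℝ} (hf : DifferentiableAt ℝ f x) :
    momentumExpr μ (fun x => (f x : ℂ)) x = -Complex.I * dunkl μ f x := by
  rw [momentumExpr, hf.hasDerivAt.ofReal_comp.deriv, dunkl]
  push_cast
  rfl

theorem dunkl_const_mul {f : ℝ → ℝ} {x : ℝ} (hf : DifferentiableAt ℝ f x) (c : ℝ) :
    dunkl μ (fun x => c * f x) x = c * dunkl μ f x := by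
  rw [dunkl, deriv_const_mul c hf, dunkl]
  ring

theorem dunkl_sum {ι : Type*} (u : Finset ι) {f : ι → ℝ → ℝ} {x : ℝ}
    (hf : ∀ i ∈ u, DifferentiableAt ℝ (f i) x) :
    dunkl μ (fun x => ∑ i ∈ u, f i x) x = ∑ i ∈ u, dunkl μ (f i) x := by
  simp only [dunkl, deriv_fun_sum hf, Finset.sum_add_distrib, ← Finset.mul_sum,
    Finset.sum_sub_distrib]

theorem dunkl_exp_neg_sq_mul {f : ℝ → ℝ} {x : ℝ} (hf : DifferentiableAt ℝ f x) :
    dunkl μ (fun x => Real.exp (-x ^ 2 / 2) * f x) x =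
      Real.exp (-x ^ 2 / 2) * (dunkl μ f x - x * f x) := by
  have h_sq : HasDerivAt (fun x : ℝ => -x ^ 2 / 2) (-x) x :=
    ((hasDerivAt_pow 2 x).neg.div_const 2).congr_deriv (by push_cast; ring)
  rw [dunkl, (h_sq.exp.fun_mul hf.hasDerivAt).deriv, neg_sq, dunkl]
  ring

theorem dunkl_pow_succ (μ : ℝ) (n : ℕ) {x : ℝ} (hx : x ≠ 0) :
    dunkl μ (fun x => x ^ (n + 1)) x = dunklFactor μ (n + 1) * x ^ n := by
  rw [dunkl, deriv_pow_field, Nat.add_sub_cancel, dunklFactor]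
  split_ifs with h_odd
  · rw [h_odd.neg_pow]
    field_simp
    ring
  · rw [(Nat.not_odd_iff_even.1 h_odd).neg_pow]
    ring

theorem dunkl_coeff_genExpSeries (hμ : -(1 / 2) < μ) (n : ℕ) {x : ℝ} (hx : x ≠ 0) :
    dunkl μ (fun x => (genExpSeries μ (2 * x)).coeff n) x =
      2 * (.X * genExpSeries μ (2 * x) : PowerSeries ℝ).coeff n := by
  simp only [genExpSeries, PowerSeries.coeff_mk]
  cases n with
  | zero => simp [dunkl]
  | succ n =>
    have h_monomial (x : ℝ) : (2 * x) ^ (n + 1) / genFactorial μ (n + 1) =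
        2 ^ (n + 1) / genFactorial μ (n + 1) * x ^ (n + 1) := by ring
    simp only [h_monomial]
    rw [dunkl_const_mul (by fun_prop), dunkl_pow_succ μ n hx, PowerSeries.coeff_succ_X_mul,
      PowerSeries.coeff_mk]
    linear_combination x ^ n * dunklFactor_mul_pow_div hμ 2 n

theorem differentiable_coeff_hermiteSeries (μ : ℝ) (n : ℕ) :
    Differentiable ℝ fun x => (hermiteSeries μ x).coeff n := by
  simp only [coeff_hermiteSeries]
  fun_prop

theorem dunkl_coeff_hermiteSeries (hμ : -(1 / 2) < μ) (n : ℕ) {x : ℝ} (hx : x ≠ 0) :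
    dunkl μ (fun x => (hermiteSeries μ x).coeff n) x =
      2 * (.X * hermiteSeries μ x : PowerSeries ℝ).coeff n := by
  have h_diff (k : ℕ) : Differentiable ℝ fun x => (genExpSeries μ (2 * x)).coeff k := by
    simp only [genExpSeries, PowerSeries.coeff_mk]
    fun_prop
  simp only [hermiteSeries, mul_left_comm (.X : PowerSeries ℝ),
    PowerSeries.coeff_mul _ (gaussSeries _)]
  rw [dunkl_sum _ fun p _ => ((h_diff p.2).const_mul _) x, Finset.mul_sum]
  refine Finset.sum_congr rfl fun p _ => ?_
  rw [dunkl_const_mul (h_diff p.2 x), dunkl_coeff_genExpSeries hμ _ hx, mul_left_comm]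

theorem differentiable_realHermiteFun (μ : ℝ) (n : ℕ) : Differentiable ℝ (realHermiteFun μ n) := by
  have := differentiable_coeff_hermiteSeries μ n
  unfold realHermiteFun
  fun_prop

theorem dunkl_realHermiteFun (hμ : -(1 / 2) < μ) (n : ℕ) {x : ℝ} (hx : x ≠ 0) :
    dunkl μ (realHermiteFun μ n) x =
      ladderCoeff μ n * realHermiteFun μ (n - 1) x -
        ladderCoeff μ (n + 1) * realHermiteFun μ (n + 1) x := by
  have h_diff := differentiable_coeff_hermiteSeries μ n
  have h_pred := ladderCoeff_mul_realHermiteFun_pred hμ n x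
  have h_position := mul_realHermiteFun hμ n x
  unfold realHermiteFun at h_pred h_position ⊢
  rw [dunkl_const_mul (by fun_prop), dunkl_exp_neg_sq_mul (h_diff x),
    dunkl_coeff_hermiteSeries hμ n hx]
  linear_combination -h_position - 2 * h_pred

end Hermite

section Completeness

variable {μ : ℝ} {E : Type*} [NormedAddCommGroup E] [NormedSpace ℝ E]

/-! ### The Hermite basis -/

theorem aestronglyMeasurable_of_integrable_exp_smul {ν : Measure ℝ} {h : ℝ → E}
    (h_int : Integrable (fun x => Real.exp (-(1 / 2) * x ^ 2) • h x) ν) :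
    AEStronglyMeasurable h ν := by
  have h_smul : AEStronglyMeasurable
      (fun x => Real.exp (1 / 2 * x ^ 2) • Real.exp (-(1 / 2) * x ^ 2) • h x) ν :=
    AEStronglyMeasurable.smul (by fun_prop) h_int.aestronglyMeasurable
  simpa [smul_smul, ← Real.exp_add] using h_smul

theorem integrable_pow_mul_realHermiteFun_smul {h : ℝ → E}
    (h_int : ∀ c : ℝ, Integrable (fun x => Real.exp (c * |x| - 1 / 2 * x ^ 2) • h x)
      (weightMeasure μ)) (N n : ℕ) :
    Integrable (fun x => (x ^ N * realHermiteFun μ n x) • h x) (weightMeasure μ) := by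
  obtain ⟨C, h_le⟩ := exists_abs_realHermiteFun_le μ n
  have h_meas : AEStronglyMeasurable h (weightMeasure μ) :=
    aestronglyMeasurable_of_integrable_exp_smul (by simpa using h_int 0)
  have := continuous_realHermiteFun μ n
  refine ((h_int 3).norm.const_mul (N ! * C)).mono'
    (AEStronglyMeasurable.smul (by fun_prop) h_meas) (.of_forall fun x => ?_)
  have h_pow := Real.pow_div_factorial_le_exp |x| (abs_nonneg x) N
  rw [div_le_iff₀' (by positivity)] at h_pow
  rw [norm_smul, norm_smul, ← mul_assoc, Real.norm_eq_abs, Real.norm_eq_abs, Real.abs_exp, abs_mul,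
    abs_pow]
  refine mul_le_mul_of_nonneg_right ?_ (norm_nonneg _)
  calc |x| ^ N * |realHermiteFun μ n x|
      ≤ (N ! * Real.exp |x|) * (C * Real.exp (2 * |x| - 1 / 2 * x ^ 2)) := by gcongr; exact h_le x
    _ = N ! * C * (Real.exp |x| * Real.exp (2 * |x| - 1 / 2 * x ^ 2)) := by ring
    _ = N ! * C * Real.exp (3 * |x| - 1 / 2 * x ^ 2) := by rw [← Real.exp_add]; ring_nf

theorem integral_pow_mul_realHermiteFun_smul_eq_zero (hμ : -(1 / 2) < μ) {h : ℝ → E}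
    (h_int : ∀ c : ℝ, Integrable (fun x => Real.exp (c * |x| - 1 / 2 * x ^ 2) • h x)
      (weightMeasure μ))
    (h_orth : ∀ n, ∫ x, realHermiteFun μ n x • h x ∂(weightMeasure μ) = 0) (N n : ℕ) :
    ∫ x, (x ^ N * realHermiteFun μ n x) • h x ∂(weightMeasure μ) = 0 := by
  induction N generalizing n with
  | zero => simpa using h_orth n
  | succ N ih =>
    have h_rec (x : ℝ) : (x ^ (N + 1) * realHermiteFun μ n x) • h x =
        ladderCoeff μ (n + 1) • (x ^ N * realHermiteFun μ (n + 1) x) • h x +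
          ladderCoeff μ n • (x ^ N * realHermiteFun μ (n - 1) x) • h x := by
      rw [pow_succ, mul_assoc, mul_realHermiteFun hμ, smul_smul, smul_smul, ← add_smul]
      ring_nf
    have h_int' (k : ℕ) := integrable_pow_mul_realHermiteFun_smul h_int N k
    simp only [h_rec]
    rw [integral_add (by exact (h_int' _).smul _) (by exact (h_int' _).smul _), integral_smul,
      integral_smul, ih, ih, smul_zero, smul_zero, add_zero]

theorem realHermiteFun_zero (hμ : -(1 / 2) < μ) (x : ℝ) :
    realHermiteFun μ 0 x = hermiteScale μ 0 * Real.exp (-x ^ 2 / 2) := by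
  rw [realHermiteFun, coeff_hermiteSeries_zero hμ, mul_one]

theorem ae_eq_zero_of_realHermiteFun_orthogonal [SecondCountableTopology E] [CompleteSpace E]
    (hμ : -(1 / 2) < μ) {h : ℝ → E}
    (h_int : ∀ c : ℝ, Integrable (fun x => Real.exp (c * |x| - 1 / 2 * x ^ 2) • h x)
      (weightMeasure μ))
    (h_orth : ∀ n, ∫ x, realHermiteFun μ n x • h x ∂(weightMeasure μ) = 0) :
    h =ᵐ[weightMeasure μ] 0 := by
  have h_moments : (fun x => realHermiteFun μ 0 x • h x) =ᵐ[weightMeasure μ] 0 := by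
    refine ae_eq_zero_of_moments_eq_zero (fun c => ?_) fun N => ?_
    · refine ((h_int c).smul (hermiteScale μ 0)).congr (.of_forall fun x => ?_)
      simp only [Pi.smul_apply, smul_smul, realHermiteFun_zero hμ,
        mul_left_comm (Real.exp (c * |x|)), ← Real.exp_add]
      ring_nf
    · simpa only [smul_smul] using
        integral_pow_mul_realHermiteFun_smul_eq_zero hμ h_int h_orth N 0
  filter_upwards [h_moments] with x hx
  refine (smul_eq_zero.1 hx).resolve_left ?_
  rw [realHermiteFun_zero hμ]
  exact (mul_pos (hermiteScale_pos hμ 0) (Real.exp_pos _)).ne'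

end Completeness

section DunklTransform

theorem integrable_exp_smul_of_memLp {μ : ℝ} (hμ : -(1 / 2) < μ) {f : ℝ → ℂ}
    (hf : MemLp f 2 (weightMeasure μ)) (c : ℝ) :
    Integrable (fun x => Real.exp (c * |x| - 1 / 2 * x ^ 2) • f x) (weightMeasure μ) := by
  have h_exp : MemLp (fun x => Real.exp (c * |x| - 1 / 2 * x ^ 2)) 2 (weightMeasure μ) :=
    memLp_two_of_norm_le_exp hμ one_half_pos (C := 1) (c := c) (by fun_prop)
      fun x => by rw [Real.norm_of_nonneg (Real.exp_pos _).le, one_mul]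
  exact (memLp_one_iff_integrable.1 (hf.smul h_exp)).congr (.of_forall fun _ => rfl)

theorem integrable_exp_smul_ofReal_mul_of_memLp {μ : ℝ} (hμ : -(1 / 2) < μ) {f : ℝ → ℂ}
    (hf : MemLp f 2 (weightMeasure μ)) (c : ℝ) :
    Integrable (fun x => Real.exp (c * |x| - 1 / 2 * x ^ 2) • ((x : ℂ) * f x))
      (weightMeasure μ) := by
  have h_exp : MemLp (fun x => x * Real.exp (c * |x| - 1 / 2 * x ^ 2)) 2 (weightMeasure μ) := by
    refine memLp_two_of_norm_le_exp hμ one_half_pos (C := 1) (c := c + 1) (by fun_prop)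
      fun x => ?_
    have h_le : |x| ≤ Real.exp |x| := by linarith [Real.add_one_le_exp |x|]
    rw [norm_mul, Real.norm_of_nonneg (Real.exp_pos _).le, one_mul, Real.norm_eq_abs,
      show (c + 1) * |x| - 1 / 2 * x ^ 2 = |x| + (c * |x| - 1 / 2 * x ^ 2) by ring, Real.exp_add]
    gcongr
  refine (memLp_one_iff_integrable.1 (hf.smul h_exp)).congr (.of_forall fun x => ?_)
  simp only [Pi.smul_apply', Complex.real_smul]
  push_cast
  ring

variable {μ : ℝ} (hμ : -(1 / 2) < μ)

/-- The generalized Hermite function `hermiteFun μ n` as a vector of `L2 μ`. -/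
def hermiteVec (n : ℕ) : L2 μ :=
  (memLp_realHermiteFun hμ n).ofReal.toLp _

theorem coeFn_hermiteVec (n : ℕ) :
    hermiteVec hμ n =ᵐ[weightMeasure μ] fun x => (realHermiteFun μ n x : ℂ) :=
  MemLp.coeFn_toLp _

theorem inner_hermiteVec_left (n : ℕ) (f : L2 μ) :
    ⟪hermiteVec hμ n, f⟫_ℂ = ∫ x, realHermiteFun μ n x • f x ∂(weightMeasure μ) := by
  rw [L2.inner_def]
  refine integral_congr_ae ?_
  filter_upwards [coeFn_hermiteVec hμ n] with x hx
  simp [hx, mul_comm]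

theorem orthonormal_hermiteVec : Orthonormal ℂ (hermiteVec hμ) := by
  rw [orthonormal_iff_ite]
  intro m n
  calc ⟪hermiteVec hμ m, hermiteVec hμ n⟫_ℂ
      = ∫ x, ((realHermiteFun μ m x * realHermiteFun μ n x : ℝ) : ℂ) ∂(weightMeasure μ) := by
        rw [inner_hermiteVec_left]
        refine integral_congr_ae ?_
        filter_upwards [coeFn_hermiteVec hμ n] with x hx
        simp [hx]
    _ = if m = n then 1 else 0 := by
        rw [integral_complex_ofReal, integral_realHermiteFun_mul hμ]
        split_ifs <;> simp

theorem eq_zero_of_inner_hermiteVec_eq_zero {f : L2 μ} (hf : ∀ n, ⟪hermiteVec hμ n, f⟫_ℂ = 0) :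
    f = 0 :=
  (Lp.eq_zero_iff_ae_eq_zero).2 <|
    ae_eq_zero_of_realHermiteFun_orthogonal hμ (integrable_exp_smul_of_memLp hμ (Lp.memLp f))
      fun n => (inner_hermiteVec_left hμ n f).symm.trans (hf n)

/-- The Hilbert basis of the generalized Hermite functions. -/
def hermiteBasis : HilbertBasis ℕ ℂ (L2 μ) :=
  HilbertBasis.mkOfOrthogonalEqBot (orthonormal_hermiteVec hμ) <| by
    rw [Submodule.eq_bot_iff]
    exact fun f hf => eq_zero_of_inner_hermiteVec_eq_zero hμ fun n =>
      (Submodule.mem_orthogonal _ _).1 hf _ (Submodule.subset_span ⟨n, rfl⟩)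

theorem hermiteBasis_apply (n : ℕ) : hermiteBasis hμ n = hermiteVec hμ n := by
  rw [hermiteBasis, HilbertBasis.coe_mkOfOrthogonalEqBot]

/-! ### The Dunkl transform and the momentum operator -/

/-- The Dunkl transform, which for `μ = 0` is the Fourier transform: the unitary operator with
`φ_n ↦ (-i)ⁿ φ_n` for the generalized Hermite functions `φ_n`. -/
def dunklTransform : L2 μ ≃ₗᵢ[ℂ] L2 μ :=
  phaseUnitary (hermiteBasis hμ) (c := fun n => (-Complex.I) ^ n) (by simp)

theorem dunklTransform_hermiteVec (n : ℕ) :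
    dunklTransform hμ (hermiteVec hμ n) = (-Complex.I) ^ n • hermiteVec hμ n := by
  rw [← hermiteBasis_apply]
  exact phaseUnitary_apply_basis _ _ n

/-- The image `-i (a_n φ_{n-1} - a_{n+1} φ_{n+1})` of the Hermite function `φ_n` under the
momentum operator; for `n = 0` the first term vanishes because `a_0 = 0`. -/
def momentumHermiteVec (n : ℕ) : L2 μ :=
  (-Complex.I * ladderCoeff μ n) • hermiteVec hμ (n - 1) +
    (Complex.I * ladderCoeff μ (n + 1)) • hermiteVec hμ (n + 1)

theorem coeFn_smul_add_smul_hermiteVec (a b : ℂ) (m n : ℕ) :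
    (a • hermiteVec hμ m + b • hermiteVec hμ n : L2 μ) =ᵐ[weightMeasure μ]
      fun x => a * realHermiteFun μ m x + b * realHermiteFun μ n x := by
  filter_upwards [coeFn_hermiteVec hμ m, coeFn_hermiteVec hμ n, Lp.coeFn_smul a (hermiteVec hμ m),
    Lp.coeFn_smul b (hermiteVec hμ n), Lp.coeFn_add (a • hermiteVec hμ m) (b • hermiteVec hμ n)]
    with x hm hn hsmul_m hsmul_n hadd
  rw [hadd, Pi.add_apply, hsmul_m, hsmul_n, Pi.smul_apply, Pi.smul_apply, hm, hn, smul_eq_mul,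
    smul_eq_mul]

theorem mem_momentumGraph_hermiteVec (n : ℕ) :
    (hermiteVec hμ n, momentumHermiteVec hμ n) ∈ momentumGraph μ := by
  have h_fun : hermiteFun μ n = fun x => (realHermiteFun μ n x : ℂ) :=
    funext (hermiteFun_eq μ n)
  refine ⟨hermiteFun μ n, Submodule.subset_span ⟨n, rfl⟩, ?_, ?_⟩
  · rw [h_fun]
    exact coeFn_hermiteVec hμ n
  · filter_upwards [coeFn_smul_add_smul_hermiteVec hμ (-Complex.I * ladderCoeff μ n)
      (Complex.I * ladderCoeff μ (n + 1)) (n - 1) (n + 1), ae_weightMeasure_ne_zero μ] with x h hx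
    rw [momentumHermiteVec, h, h_fun, momentumExpr_ofReal (differentiable_realHermiteFun μ n x),
      dunkl_realHermiteFun hμ n hx]
    push_cast
    ring

theorem momentumGraph_eq_span :
    momentumGraph μ =
      Submodule.span ℂ (Set.range fun n => (hermiteVec hμ n, momentumHermiteVec hμ n)) := by
  set K := Submodule.span ℂ (Set.range fun n => (hermiteVec hμ n, momentumHermiteVec hμ n))
  have h_span : K ≤ momentumGraph μ := by
    rw [Submodule.span_le]
    rintro _ ⟨n, rfl⟩
    exact mem_momentumGraph_hermiteVec hμ n
  have h_exists {g : ℝ → ℂ} (hg : g ∈ hermiteSpan μ) : ∃ q ∈ K, q.1 =ᵐ[weightMeasure μ] g := by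
    induction hg using Submodule.span_induction with
    | mem _ hx =>
      obtain ⟨n, rfl⟩ := hx
      refine ⟨_, Submodule.subset_span ⟨n, rfl⟩, (coeFn_hermiteVec hμ n).trans ?_⟩
      exact .of_forall fun x => (hermiteFun_eq μ n x).symm
    | zero => exact ⟨0, zero_mem _, Lp.coeFn_zero _ _ _⟩
    | add _ _ _ _ h₁ h₂ =>
      obtain ⟨⟨p, hp, hp_ae⟩, q, hq, hq_ae⟩ := h₁, h₂
      exact ⟨p + q, add_mem hp hq, (Lp.coeFn_add _ _).trans (hp_ae.add hq_ae)⟩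
    | smul c _ _ h =>
      obtain ⟨q, hq, hq_ae⟩ := h
      exact ⟨c • q, Submodule.smul_mem _ c hq, (Lp.coeFn_smul _ _).trans (hq_ae.const_smul c)⟩
  refine le_antisymm (fun p hp => ?_) h_span
  obtain ⟨g, hg, hp_ae, -⟩ := id hp
  obtain ⟨q, hq, hq_ae⟩ := h_exists hg
  have h_fst : p.1 = q.1 := Lp.ext (hp_ae.trans hq_ae.symm)
  have h_snd : p.2 = q.2 := sub_eq_zero.1 <|
    momentumGraph_functional μ _ (sub_mem hp (h_span hq)) (sub_eq_zero.2 h_fst)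
  rwa [Prod.ext h_fst h_snd]

theorem dunklTransform_momentumHermiteVec (n : ℕ) :
    dunklTransform hμ (momentumHermiteVec hμ n) =
      ((-Complex.I) ^ n * ladderCoeff μ n) • hermiteVec hμ (n - 1) +
        ((-Complex.I) ^ n * ladderCoeff μ (n + 1)) • hermiteVec hμ (n + 1) := by
  rw [momentumHermiteVec, map_add, map_smul, map_smul, dunklTransform_hermiteVec,
    dunklTransform_hermiteVec, smul_smul, smul_smul]
  congr 2
  · rcases n with _ | n
    · simp [ladderCoeff_zero]
    · rw [Nat.add_sub_cancel, pow_succ]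
      ring
  · rw [pow_succ]
    linear_combination (-(-Complex.I) ^ n * ladderCoeff μ (n + 1)) * Complex.I_mul_I

theorem coeFn_dunklTransform_hermiteVec (n : ℕ) :
    dunklTransform hμ (hermiteVec hμ n) =ᵐ[weightMeasure μ]
      fun x => (-Complex.I) ^ n * realHermiteFun μ n x := by
  rw [dunklTransform_hermiteVec]
  filter_upwards [Lp.coeFn_smul ((-Complex.I) ^ n) (hermiteVec hμ n), coeFn_hermiteVec hμ n]
    with x h_smul h
  rw [h_smul, Pi.smul_apply, h, smul_eq_mul]

theorem momentumGraph_le_multiplierGraph :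
    momentumGraph μ ≤ multiplierGraph (dunklTransform hμ) id := by
  rw [momentumGraph_eq_span hμ, Submodule.span_le]
  rintro _ ⟨n, rfl⟩
  rw [SetLike.mem_coe, mem_multiplierGraph, dunklTransform_momentumHermiteVec]
  filter_upwards [coeFn_smul_add_smul_hermiteVec hμ _ _ _ _, coeFn_dunklTransform_hermiteVec hμ n]
    with x h_momentum h
  have h_position := congrArg Complex.ofReal (mul_realHermiteFun hμ n x)
  push_cast at h_position
  rw [h_momentum, h, id_eq]
  linear_combination -(-Complex.I) ^ n * h_position

theorem dense_momentumGraph_add_I_smul {μ : ℝ} (hμ : -(1 / 2) < μ) :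
    Dense ((fun p : L2 μ × L2 μ => p.2 + Complex.I • p.1) '' (momentumGraph μ)) := by
  set K : Submodule ℂ (L2 μ) := (momentumGraph μ).map
    (LinearMap.snd ℂ (L2 μ) (L2 μ) + Complex.I • LinearMap.fst ℂ (L2 μ) (L2 μ))
  change Dense (K : Set (L2 μ))
  rw [Submodule.dense_iff_topologicalClosure_eq_top, Submodule.topologicalClosure_eq_top_iff,
    Submodule.eq_bot_iff]
  intro f hf
  set F := dunklTransform hμ f
  have h_orth (n : ℕ) :
      ∫ x, realHermiteFun μ n x • (x * F x - Complex.I * F x) ∂(weightMeasure μ) = 0 := by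
    have h_mem : momentumHermiteVec hμ n + Complex.I • hermiteVec hμ n ∈ K :=
      ⟨_, mem_momentumGraph_hermiteVec hμ n, rfl⟩
    have h_inner := (Submodule.mem_orthogonal _ _).1 hf _ h_mem
    rw [← (dunklTransform hμ).inner_map_map, map_add, map_smul, L2.inner_def] at h_inner
    refine (mul_eq_zero.1 ?_).resolve_left (show (starRingEnd ℂ) ((-Complex.I) ^ n) ≠ 0 by simp)
    rw [← integral_const_mul, ← h_inner]
    refine integral_congr_ae ?_
    filter_upwards [mem_multiplierGraph.1
        (momentumGraph_le_multiplierGraph hμ (mem_momentumGraph_hermiteVec hμ n)),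
      coeFn_dunklTransform_hermiteVec hμ n,
      Lp.coeFn_smul Complex.I (dunklTransform hμ (hermiteVec hμ n)),
      Lp.coeFn_add (dunklTransform hμ (momentumHermiteVec hμ n))
        (Complex.I • dunklTransform hμ (hermiteVec hμ n))] with x h_momentum h h_smul h_add
    rw [h_add, Pi.add_apply, h_momentum, h_smul, Pi.smul_apply, h]
    simp only [RCLike.inner_apply, map_add, map_mul, Complex.conj_ofReal, smul_eq_mul,
      Complex.conj_I, Complex.real_smul, id_eq]
    ring
  have h_int (c : ℝ) : Integrable (fun x =>
      Real.exp (c * |x| - 1 / 2 * x ^ 2) • (x * F x - Complex.I * F x)) (weightMeasure μ) := by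
    refine ((integrable_exp_smul_ofReal_mul_of_memLp hμ (Lp.memLp F) c).sub
      ((integrable_exp_smul_of_memLp hμ (Lp.memLp F) c).const_mul Complex.I)).congr
      (.of_forall fun x => ?_)
    simp only [Pi.sub_apply, smul_sub, mul_smul_comm]
  have h_zero := ae_eq_zero_of_realHermiteFun_orthogonal hμ h_int h_orth
  refine (map_eq_zero_iff _ (dunklTransform hμ).injective).1 ((Lp.eq_zero_iff_ae_eq_zero).2 ?_)
  filter_upwards [h_zero] with x hx
  rw [Pi.zero_apply, ← sub_mul] at hx
  refine (mul_eq_zero.1 hx).resolve_left fun h => ?_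
  simpa using congrArg Complex.im h

theorem momentum_graph : (momentum μ).graph = multiplierGraph (dunklTransform hμ) id := by
  have h_closure : (momentumGraph μ).topologicalClosure = multiplierGraph (dunklTransform hμ) id :=
    topologicalClosure_eq_multiplierGraph aestronglyMeasurable_id
      (momentumGraph_le_multiplierGraph hμ) (dense_momentumGraph_add_I_smul hμ)
  have h_functional (p : L2 μ × L2 μ) (hp : p ∈ multiplierGraph (dunklTransform hμ) id)
      (h_fst : p.1 = 0) : p.2 = 0 := by
    rw [mem_multiplierGraph, h_fst, map_zero] at hp
    refine (map_eq_zero_iff _ (dunklTransform hμ).injective).1 ((Lp.eq_zero_iff_ae_eq_zero).2 ?_)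
    filter_upwards [hp, Lp.coeFn_zero ℂ 2 (weightMeasure μ)] with x hx h_zero
    rw [hx, h_zero, Pi.zero_apply, mul_zero]
  have h_closable : (momentumCore μ).IsClosable :=
    ⟨(multiplierGraph (dunklTransform hμ) id).toLinearPMap, by
      rw [momentumCore_graph, h_closure, Submodule.toLinearPMap_graph_eq _ h_functional]⟩
  rw [momentum, ← h_closable.graph_closure_eq_closure_graph, momentumCore_graph, h_closure]

end DunklTransform

section GaussExp

/-! ### Gaussians times generalized exponentials -/

/-- The function `x ↦ exp (-s x²) e_μ(a x)`. Up to scalars, the Dunkl transform and the heat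
semigroup permute these functions. -/
def gaussExp (μ s : ℝ) (a : ℂ) (x : ℝ) : ℂ :=
  Complex.exp ((-s * x ^ 2 : ℝ) : ℂ) * genExp μ (a * x)

theorem gaussExp_mul_gaussExp (μ s r : ℝ) (a b : ℂ) (x : ℝ) :
    gaussExp μ s a x * gaussExp μ r b x =
      Complex.exp ((-(s + r) * x ^ 2 : ℝ) : ℂ) * (genExp μ (a * x) * genExp μ (b * x)) := by
  rw [gaussExp, gaussExp, mul_mul_mul_comm, ← Complex.exp_add, ← Complex.ofReal_add]
  congr 4
  ring

theorem exp_mul_gaussExp (μ s t : ℝ) (a : ℂ) (x : ℝ) :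
    Real.exp (-t * x ^ 2) * gaussExp μ s a x = gaussExp μ (s + t) a x := by
  rw [gaussExp, gaussExp, ← mul_assoc, Complex.ofReal_exp, ← Complex.exp_add, ← Complex.ofReal_add]
  congr 3
  ring

theorem conj_gaussExp (μ s : ℝ) (a : ℂ) (x : ℝ) :
    (starRingEnd ℂ) (gaussExp μ s a x) = gaussExp μ s ((starRingEnd ℂ) a) x := by
  rw [gaussExp, map_mul, ← Complex.exp_conj, conj_genExp, map_mul, Complex.conj_ofReal,
    Complex.conj_ofReal, gaussExp]

theorem gaussExp_comp_mul (μ s : ℝ) (a : ℂ) (c x : ℝ) :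
    gaussExp μ s a (c * x) = gaussExp μ (s * c ^ 2) (a * c) x := by
  rw [gaussExp, gaussExp]
  push_cast
  ring_nf

section

variable {μ : ℝ} (hμ : -(1 / 2) < μ)
include hμ

theorem memLp_gaussExp {s : ℝ} (hs : 0 < s) (a : ℂ) :
    MemLp (gaussExp μ s a) 2 (weightMeasure μ) := by
  obtain ⟨C, hC⟩ := exists_norm_genExp_le hμ
  have h_meas : Measurable (gaussExp μ s a) := by
    have := measurable_genExp hμ
    unfold gaussExp
    fun_prop
  refine memLp_two_of_norm_le_exp hμ hs (C := C) (c := 2 * ‖a‖) h_meas.aestronglyMeasurable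
    fun x => ?_
  calc ‖gaussExp μ s a x‖ = Real.exp (-s * x ^ 2) * ‖genExp μ (a * x)‖ := by
        rw [gaussExp, norm_mul, Complex.norm_exp_ofReal]
    _ ≤ Real.exp (-s * x ^ 2) * (C * Real.exp (2 * ‖a * x‖)) := by gcongr; exact hC _
    _ = C * Real.exp (2 * ‖a‖ * |x| - s * x ^ 2) := by
        rw [mul_left_comm, ← Real.exp_add, norm_mul, Complex.norm_real, Real.norm_eq_abs]
        ring_nf

end

variable {μ : ℝ} (hμ : -(1 / 2) < μ)

/-- The function `gaussExp μ s a` as a vector of `L2 μ`. -/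
def gaussVec {s : ℝ} (hs : 0 < s) (a : ℂ) : L2 μ :=
  (memLp_gaussExp hμ hs a).toLp _

theorem coeFn_gaussVec {s : ℝ} (hs : 0 < s) (a : ℂ) :
    gaussVec hμ hs a =ᵐ[weightMeasure μ] gaussExp μ s a :=
  MemLp.coeFn_toLp _

theorem inner_gaussVec_left {s : ℝ} (hs : 0 < s) (a : ℂ) (f : L2 μ) :
    ⟪gaussVec hμ hs a, f⟫_ℂ =
      ∫ x, gaussExp μ s ((starRingEnd ℂ) a) x * f x ∂(weightMeasure μ) := by
  rw [L2.inner_def]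
  refine integral_congr_ae ?_
  filter_upwards [coeFn_gaussVec hμ hs a] with x hx
  rw [hx, RCLike.inner_apply', conj_gaussExp]

theorem inner_gaussVec_gaussVec {s r : ℝ} (hs : 0 < s) (hr : 0 < r) (a b : ℂ) :
    ⟪gaussVec hμ hs a, gaussVec hμ hr b⟫_ℂ =
      ∫ x, gaussExp μ s ((starRingEnd ℂ) a) x * gaussExp μ r b x ∂(weightMeasure μ) := by
  rw [inner_gaussVec_left]
  refine integral_congr_ae ?_
  filter_upwards [coeFn_gaussVec hμ hr b] with x hx
  rw [hx]

include hμ in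
theorem inv_hermiteScale_sq (n : ℕ) :
    (hermiteScale μ n)⁻¹ ^ 2 = Real.Gamma (μ + 1 / 2) * 2 ^ n / genFactorial μ n := by
  have hΓ := Gamma_add_half_pos hμ
  have hγ := genFactorial_pos hμ n
  rw [hermiteScale, inv_pow, Real.sq_sqrt (by positivity), inv_div, mul_comm]

theorem summable_norm_pow_smul_hermiteVec (z : ℂ) :
    Summable fun n => ‖(z ^ n / hermiteScale μ n) • hermiteVec hμ n‖ := by
  have h_geometric : Summable fun n : ℕ => (1 / 4 : ℝ) ^ n :=
    summable_geometric_of_lt_one (by norm_num) (by norm_num)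
  have h_genExp := (summable_norm_pow_div_genFactorial hμ (8 * ‖z‖ ^ 2)).mul_left
    (Real.Gamma (μ + 1 / 2))
  refine .of_nonneg_of_le (fun _ => norm_nonneg _) (fun n => ?_)
    ((h_geometric.add h_genExp).mul_left (1 / 2))
  have h_norm : ‖(z ^ n / hermiteScale μ n) • hermiteVec hμ n‖ =
      ‖z‖ ^ n * (hermiteScale μ n)⁻¹ := by
    rw [norm_smul, (orthonormal_hermiteVec hμ).1, mul_one, norm_div, norm_pow, Complex.norm_real,
      Real.norm_of_nonneg (hermiteScale_pos hμ n).le, div_eq_mul_inv]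
  have h_norm_genExp : ‖(8 * (‖z‖ : ℂ) ^ 2) ^ n / (genFactorial μ n : ℂ)‖ =
      (8 * ‖z‖ ^ 2) ^ n / genFactorial μ n := by
    rw [norm_div, Complex.norm_real, Real.norm_of_nonneg (genFactorial_pos hμ n).le]
    simp
  calc ‖(z ^ n / hermiteScale μ n) • hermiteVec hμ n‖
      = (1 / 2) ^ n * (2 ^ n * (‖z‖ ^ n * (hermiteScale μ n)⁻¹)) := by
        rw [h_norm, ← mul_assoc (_ ^ n), ← mul_pow, one_div_mul_cancel two_ne_zero, one_pow,
          one_mul]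
    _ ≤ 1 / 2 * (((1 / 2) ^ n) ^ 2 + (2 ^ n * (‖z‖ ^ n * (hermiteScale μ n)⁻¹)) ^ 2) := by
        linarith [two_mul_le_add_sq ((1 / 2 : ℝ) ^ n) (2 ^ n * (‖z‖ ^ n * (hermiteScale μ n)⁻¹))]
    _ = _ := by
        rw [h_norm_genExp, mul_pow (2 ^ n), mul_pow (‖z‖ ^ n), inv_hermiteScale_sq hμ, ← pow_mul',
          ← pow_mul', pow_mul (1 / 2 : ℝ), pow_mul (2 : ℝ), show (8 : ℝ) = 2 ^ 2 * 2 by norm_num,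
          show (1 / 4 : ℝ) = (1 / 2) ^ 2 by norm_num, mul_pow, mul_pow (2 ^ 2)]
        ring

theorem hasSum_pow_smul_hermiteVec (a : ℂ) :
    HasSum (fun n => ((a / 2) ^ n / hermiteScale μ n) • hermiteVec hμ n)
      (Complex.exp (-(a ^ 2 / 4)) • gaussVec hμ one_half_pos a) := by
  have h_summable := summable_norm_pow_smul_hermiteVec hμ (a / 2)
  convert h_summable.of_norm.hasSum using 1
  refine Lp.ext ?_
  have h_coeFn : ∀ᵐ x ∂(weightMeasure μ), ∀ n,
      ((((a / 2) ^ n / hermiteScale μ n) • hermiteVec hμ n : L2 μ) x) =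
        (a / 2) ^ n / hermiteScale μ n * realHermiteFun μ n x := by
    refine ae_all_iff.2 fun n => ?_
    filter_upwards [Lp.coeFn_smul ((a / 2) ^ n / (hermiteScale μ n : ℂ)) (hermiteVec hμ n),
      coeFn_hermiteVec hμ n] with x h_smul h
    rw [h_smul, Pi.smul_apply, h, smul_eq_mul]
  filter_upwards [Lp.hasSum_coeFn_tsum (tsum_enorm_ne_top_iff_summable_norm.2 h_summable), h_coeFn,
    Lp.coeFn_smul (Complex.exp (-(a ^ 2 / 4))) (gaussVec hμ one_half_pos a),
    coeFn_gaussVec hμ one_half_pos a] with x h_tsum h_terms h_smul h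
  rw [h_smul, Pi.smul_apply, h, smul_eq_mul]
  refine HasSum.unique ?_ h_tsum
  have h_value : Complex.exp ((-x ^ 2 / 2 : ℝ) : ℂ) *
      (Complex.exp (-(a / 2) ^ 2) * genExp μ (2 * x * (a / 2))) =
        Complex.exp (-(a ^ 2 / 4)) * gaussExp μ (1 / 2) a x := by
    rw [gaussExp, mul_left_comm]
    ring_nf
  rw [← h_value]
  refine ((hasSum_hermiteSeries hμ (a / 2) x).mul_left _).congr_fun fun n => ?_
  have h_scale : (hermiteScale μ n : ℂ) ≠ 0 := by exact_mod_cast (hermiteScale_pos hμ n).ne'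
  rw [h_terms, realHermiteFun]
  push_cast
  field_simp

theorem inner_hermiteVec_gaussVec (n : ℕ) (a : ℂ) :
    ⟪hermiteVec hμ n, gaussVec hμ one_half_pos a⟫_ℂ =
      Complex.exp (a ^ 2 / 4) * ((a / 2) ^ n / hermiteScale μ n) := by
  have h_sum := (hasSum_pow_smul_hermiteVec hμ a).mapL (innerSL ℂ (hermiteVec hμ n))
  have h_single := h_sum.unique (hasSum_single n fun m hm => by
    simp [(orthonormal_hermiteVec hμ).2 hm.symm])
  simp only [innerSL_apply_apply, inner_smul_right, inner_self_eq_norm_sq_to_K,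
    (orthonormal_hermiteVec hμ).1, RCLike.ofReal_one, one_pow, mul_one] at h_single
  rw [← h_single, ← mul_assoc, ← Complex.exp_add, add_neg_cancel, Complex.exp_zero, one_mul]

theorem inner_gaussVec_half (a b : ℂ) :
    ⟪gaussVec hμ one_half_pos a, gaussVec hμ one_half_pos b⟫_ℂ =
      Real.Gamma (μ + 1 / 2) * (Complex.exp (((starRingEnd ℂ) a ^ 2 + b ^ 2) / 4) *
        genExp μ ((starRingEnd ℂ) a * b / 2)) := by
  refine ((hermiteBasis hμ).hasSum_inner_mul_inner (gaussVec hμ one_half_pos a)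
    (gaussVec hμ one_half_pos b)).unique ?_
  rw [← mul_assoc]
  refine ((hasSum_genExp hμ _).mul_left _).congr_fun fun n => ?_
  have h_scale := congrArg Complex.ofReal (inv_hermiteScale_sq hμ n)
  push_cast at h_scale
  rw [hermiteBasis_apply, ← inner_conj_symm, inner_hermiteVec_gaussVec, inner_hermiteVec_gaussVec,
    add_div, Complex.exp_add]
  simp only [map_mul, map_div₀, map_pow, ← Complex.exp_conj, Complex.conj_ofReal, map_ofNat]
  rw [show (starRingEnd ℂ) a * b / 2 = 2 * ((starRingEnd ℂ) a / 2 * (b / 2)) by ring, mul_pow 2,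
    mul_pow (_ / 2)]
  linear_combination Complex.exp ((starRingEnd ℂ) a ^ 2 / 4) * Complex.exp (b ^ 2 / 4) *
    (((starRingEnd ℂ) a / 2) ^ n * (b / 2) ^ n) * h_scale

theorem dunklTransform_gaussVec_half (a : ℂ) :
    dunklTransform hμ (gaussVec hμ one_half_pos a) =
      Complex.exp (a ^ 2 / 2) • gaussVec hμ one_half_pos (-Complex.I * a) := by
  have h_sum := (hasSum_pow_smul_hermiteVec hμ a).mapL
    ((dunklTransform hμ).toContinuousLinearEquiv : L2 μ →L[ℂ] L2 μ)
  have h_eq := h_sum.unique <| (hasSum_pow_smul_hermiteVec hμ (-Complex.I * a)).congr_fun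
    fun n => by
      change dunklTransform hμ _ = _
      rw [map_smul, dunklTransform_hermiteVec, smul_smul]
      congr 1
      rw [mul_div_assoc (-Complex.I), mul_pow (-Complex.I)]
      ring
  change dunklTransform hμ _ = _ at h_eq
  rw [map_smul, ← eq_inv_smul_iff₀ (Complex.exp_ne_zero _), smul_smul, ← Complex.exp_neg,
    ← Complex.exp_add] at h_eq
  rw [h_eq, mul_pow, neg_sq, Complex.I_sq]
  ring_nf

theorem eq_zero_of_inner_gaussVec_eq_zero {f : L2 μ}
    (hf : ∀ a, ⟪f, gaussVec hμ one_half_pos a⟫_ℂ = 0) : f = 0 := by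
  set p := FormalMultilinearSeries.ofScalars ℂ fun n =>
    ⟪f, hermiteVec hμ n⟫_ℂ / hermiteScale μ n
  have h_series : HasFPowerSeriesAt (0 : ℂ → ℂ) p 0 := by
    refine hasFPowerSeriesAt_iff.2 (.of_forall fun z => ?_)
    have h_sum := (hasSum_pow_smul_hermiteVec hμ (2 * z)).mapL (innerSL ℂ f)
    simp only [innerSL_apply_apply, inner_smul_right, hf, mul_zero] at h_sum
    refine h_sum.congr_fun fun n => ?_
    rw [FormalMultilinearSeries.coeff_ofScalars, smul_eq_mul, mul_div_cancel_left₀ z two_ne_zero]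
    ring
  refine eq_zero_of_inner_hermiteVec_eq_zero hμ fun n => ?_
  have h_coeff := congrArg (fun q => FormalMultilinearSeries.coeff q n) h_series.eq_zero
  rw [FormalMultilinearSeries.coeff_ofScalars, FormalMultilinearSeries.coeff,
    FormalMultilinearSeries.zero_apply, zero_apply, div_eq_zero_iff] at h_coeff
  exact inner_eq_zero_symm.1
    (h_coeff.resolve_right (Complex.ofReal_ne_zero.2 (hermiteScale_pos hμ n).ne'))

theorem topologicalClosure_span_gaussVec :
    (Submodule.span ℂ (Set.range (gaussVec hμ one_half_pos))).topologicalClosure = ⊤ := by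
  rw [Submodule.topologicalClosure_eq_top_iff, Submodule.eq_bot_iff]
  exact fun f hf => eq_zero_of_inner_gaussVec_eq_zero hμ fun a =>
    (Submodule.mem_orthogonal' _ _).1 hf _ (Submodule.subset_span ⟨a, rfl⟩)

include hμ in
theorem integral_gaussExp_mul_gaussExp {s r : ℝ} (hs : 0 < s) (hr : 0 < r) (a b : ℂ) :
    ∫ x, gaussExp μ s a x * gaussExp μ r b x ∂(weightMeasure μ) =
      (Real.Gamma (μ + 1 / 2) * ((s + r) ^ (μ + 1 / 2))⁻¹ : ℝ) *
        (Complex.exp ((a ^ 2 + b ^ 2) / (4 * (s + r))) * genExp μ (a * b / (2 * (s + r)))) := by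
  set c := √(s + r)
  have hc : 0 < c := Real.sqrt_pos.2 (add_pos hs hr)
  have hc_sq : c ^ 2 = s + r := Real.sq_sqrt (add_pos hs hr).le
  have hc_rpow : c ^ (2 * μ + 1) = (s + r) ^ (μ + 1 / 2) := by
    rw [← hc_sq, ← Real.rpow_natCast_mul hc.le]
    congr 1
    push_cast
    ring
  have h_half : ∫ x, gaussExp μ (1 / 2) (a / c) x * gaussExp μ (1 / 2) (b / c) x
      ∂(weightMeasure μ) = Real.Gamma (μ + 1 / 2) *
        (Complex.exp (((a / c) ^ 2 + (b / c) ^ 2) / 4) * genExp μ (a / c * (b / c) / 2)) := by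
    have h := inner_gaussVec_half hμ ((starRingEnd ℂ) (a / c)) (b / c)
    rwa [inner_gaussVec_gaussVec, Complex.conj_conj] at h
  have hc_ne : (c : ℂ) ≠ 0 := Complex.ofReal_ne_zero.2 hc.ne'
  have hc_sq' : (c : ℂ) ^ 2 = s + r := by exact_mod_cast hc_sq
  calc ∫ x, gaussExp μ s a x * gaussExp μ r b x ∂(weightMeasure μ)
      = ∫ x, gaussExp μ (1 / 2) (a / c) (c * x) * gaussExp μ (1 / 2) (b / c) (c * x)
          ∂(weightMeasure μ) := by
        simp only [gaussExp_comp_mul, div_mul_cancel₀ _ hc_ne, gaussExp_mul_gaussExp, ← add_mul,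
          add_halves, one_mul, hc_sq]
    _ = ((s + r) ^ (μ + 1 / 2))⁻¹ • ((Real.Gamma (μ + 1 / 2) : ℂ) *
          (Complex.exp (((a / c) ^ 2 + (b / c) ^ 2) / 4) * genExp μ (a / c * (b / c) / 2))) := by
        rw [integral_weightMeasure_comp_mul μ
          (fun x => gaussExp μ (1 / 2) (a / c) x * gaussExp μ (1 / 2) (b / c) x) hc, h_half,
          hc_rpow]
    _ = _ := by
        rw [div_pow, div_pow, ← add_div, div_mul_div_comm, ← sq, hc_sq', div_div, div_div,
          mul_comm _ (4 : ℂ), mul_comm _ (2 : ℂ), Complex.real_smul, ← mul_assoc,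
          ← Complex.ofReal_mul, mul_comm (_⁻¹)]

theorem inner_gaussVec {s r : ℝ} (hs : 0 < s) (hr : 0 < r) (a b : ℂ) :
    ⟪gaussVec hμ hs a, gaussVec hμ hr b⟫_ℂ =
      (Real.Gamma (μ + 1 / 2) * ((s + r) ^ (μ + 1 / 2))⁻¹ : ℝ) *
        (Complex.exp (((starRingEnd ℂ) a ^ 2 + b ^ 2) / (4 * (s + r))) *
          genExp μ ((starRingEnd ℂ) a * b / (2 * (s + r)))) := by
  rw [inner_gaussVec_gaussVec, integral_gaussExp_mul_gaussExp hμ hs hr]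

end GaussExp

section HeatSemigroup

variable {μ : ℝ} (hμ : -(1 / 2) < μ)

theorem coeFn_smul_gaussVec {s : ℝ} (hs : 0 < s) (c a : ℂ) :
    (c • gaussVec hμ hs a : L2 μ) =ᵐ[weightMeasure μ] fun x => c * gaussExp μ s a x := by
  filter_upwards [Lp.coeFn_smul c (gaussVec hμ hs a), coeFn_gaussVec hμ hs a] with x h_smul h
  rw [h_smul, Pi.smul_apply, h, smul_eq_mul]

theorem eq_of_inner_gaussVec_left_eq {f g : L2 μ}
    (h : ∀ a, ⟪gaussVec hμ one_half_pos a, f⟫_ℂ = ⟪gaussVec hμ one_half_pos a, g⟫_ℂ) : f = g :=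
  sub_eq_zero.1 <| eq_zero_of_inner_gaussVec_eq_zero hμ fun a => by
    rw [inner_eq_zero_symm, inner_sub_right, h, sub_self]

theorem inner_gaussVec_dunklTransform (a : ℂ) (f : L2 μ) :
    ⟪gaussVec hμ one_half_pos a, dunklTransform hμ f⟫_ℂ =
      Complex.exp ((starRingEnd ℂ) a ^ 2 / 2) *
        ⟪gaussVec hμ one_half_pos (Complex.I * a), f⟫_ℂ := by
  rw [← (dunklTransform hμ).inner_map_map (gaussVec hμ one_half_pos (Complex.I * a)),
    dunklTransform_gaussVec_half, inner_smul_left, ← mul_assoc, ← Complex.exp_conj,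
    ← Complex.exp_add, ← mul_assoc (-Complex.I), neg_mul, Complex.I_mul_I, neg_neg, one_mul,
    mul_pow, Complex.I_sq]
  simp [neg_div, map_ofNat]

theorem dunklTransform_gaussVec {s : ℝ} (hs : 0 < s) (a : ℂ) :
    dunklTransform hμ (gaussVec hμ hs a) =
      ((((2 * s) ^ (μ + 1 / 2))⁻¹ : ℝ) * Complex.exp (a ^ 2 / (4 * s))) •
        gaussVec hμ (by positivity : 0 < 1 / (4 * s)) (-Complex.I * a / (2 * s)) := by
  refine eq_of_inner_gaussVec_left_eq hμ fun b => ?_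
  have hs_ne : (s : ℂ) ≠ 0 := Complex.ofReal_ne_zero.2 hs.ne'
  obtain ⟨q, hq⟩ : ∃ q, q = 1 + 2 * s := ⟨_, rfl⟩
  have hq_pos : 0 < q := by rw [hq]; positivity
  have hq_ne : (q : ℂ) ≠ 0 := Complex.ofReal_ne_zero.2 hq_pos.ne'
  have h_add : 1 / 2 + s = q / 2 := by rw [hq]; ring
  have h_add_inv : 1 / 2 + 1 / (4 * s) = q / (4 * s) := by rw [hq]; field_simp; ring
  have h_scalar : ((q / 2) ^ (μ + 1 / 2))⁻¹ =
      ((2 * s) ^ (μ + 1 / 2))⁻¹ * ((q / (4 * s)) ^ (μ + 1 / 2))⁻¹ := by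
    rw [← mul_inv, ← Real.mul_rpow (by positivity) (by positivity)]
    congr 2
    field_simp
    ring
  have h_exp : Complex.exp ((starRingEnd ℂ) b ^ 2 / 2) *
      Complex.exp (((starRingEnd ℂ) (Complex.I * b) ^ 2 + a ^ 2) / (4 * (q / 2 : ℝ))) =
      Complex.exp (a ^ 2 / (4 * s)) * Complex.exp (((starRingEnd ℂ) b ^ 2 +
        (-Complex.I * a / (2 * s)) ^ 2) / (4 * (q / (4 * s) : ℝ))) := by
    rw [← Complex.exp_add, ← Complex.exp_add, map_mul, Complex.conj_I, div_pow, mul_pow, mul_pow,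
      neg_sq, Complex.I_sq]
    congr 1
    push_cast
    field_simp
    rw [hq]
    push_cast
    ring
  have h_arg : (starRingEnd ℂ) (Complex.I * b) * a / (2 * (q / 2 : ℝ)) =
      (starRingEnd ℂ) b * (-Complex.I * a / (2 * s)) / (2 * (q / (4 * s) : ℝ)) := by
    rw [map_mul, Complex.conj_I]
    push_cast
    field_simp
    ring
  rw [inner_gaussVec_dunklTransform, inner_smul_right, inner_gaussVec, inner_gaussVec,
    ← Complex.ofReal_add, ← Complex.ofReal_add, h_add, h_add_inv, h_scalar, h_arg, mul_left_comm,
    ← mul_assoc (Complex.exp _) (Complex.exp _), h_exp, ← mul_assoc (Real.Gamma _),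
    Complex.ofReal_mul, Complex.ofReal_mul, Complex.ofReal_mul]
  ring

/-! ### The heat semigroup -/

theorem memLp_top_exp_neg_mul_sq {t : ℝ} (ht : 0 ≤ t) (ν : Measure ℝ) :
    MemLp (fun l => Real.exp (-t * l ^ 2)) ∞ ν :=
  memLp_top_of_bound (by fun_prop) 1 <| .of_forall fun l => by
    rw [Real.norm_of_nonneg (Real.exp_pos _).le, Real.exp_le_one_iff]
    nlinarith [sq_nonneg l]

/-- The heat semigroup `exp (-t P²)` of the momentum operator `P`: multiplication by `exp (-t l²)`
on the side of the Dunkl transform. -/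
def heatSemigroup (t : ℝ) : L2 μ →L[ℂ] L2 μ :=
  multiplier (dunklTransform hμ) fun l => Real.exp (-t * l ^ 2)

theorem isBorelFunctionOf_heatSemigroup {t : ℝ} (ht : 0 ≤ t) :
    IsBorelFunctionOf (momentum μ) (fun l => Real.exp (-t * l ^ 2)) (heatSemigroup hμ t) :=
  isBorelFunctionOf_multiplier measurable_id (momentum_graph hμ) (by fun_prop)
    (memLp_top_exp_neg_mul_sq ht _)

theorem heatSemigroup_add {s t : ℝ} (hs : 0 ≤ s) (ht : 0 ≤ t) :
    heatSemigroup hμ (s + t) = (heatSemigroup hμ s).comp (heatSemigroup hμ t) := by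
  rw [heatSemigroup, heatSemigroup, heatSemigroup,
    ← multiplier_mul (memLp_top_exp_neg_mul_sq hs _) (memLp_top_exp_neg_mul_sq ht _)]
  congr 1
  ext l
  rw [Pi.mul_apply, ← Real.exp_add]
  ring_nf

theorem tendsto_heatSemigroup (f : L2 μ) :
    Tendsto (fun t => heatSemigroup hμ t f) (𝓝[≥] 0) (𝓝 f) := by
  have h := tendsto_multiplier (U := dunklTransform hμ) (l := 𝓝[≥] (0 : ℝ))
    (m := fun t l => Real.exp (-t * l ^ 2)) (k := 1) (C := 1)
    (.of_forall fun t => by fun_prop)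
    (by
      filter_upwards [self_mem_nhdsWithin] with t ht l
      rw [Real.norm_of_nonneg (Real.exp_pos _).le, Real.exp_le_one_iff]
      nlinarith [sq_nonneg l, Set.mem_Ici.1 ht])
    (memLp_top_const 1)
    (fun l => by
      have h_cont : Continuous fun t : ℝ => Real.exp (-t * l ^ 2) := by fun_prop
      simpa using (h_cont.tendsto 0).mono_left nhdsWithin_le_nhds) f
  rwa [multiplier_one] at h

theorem heatSemigroup_gaussVec {s t : ℝ} (hs : 0 < s) (ht : 0 ≤ t) (a : ℂ) :
    heatSemigroup hμ t (gaussVec hμ hs a) =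
      ((((1 + 4 * s * t) ^ (μ + 1 / 2))⁻¹ : ℝ) *
          Complex.exp (a ^ 2 * t / (1 + 4 * s * t : ℝ))) •
        gaussVec hμ (by positivity : 0 < s / (1 + 4 * s * t)) (a / (1 + 4 * s * t : ℝ)) := by
  obtain ⟨k, hk⟩ : ∃ k, k = 1 + 4 * s * t := ⟨_, rfl⟩
  have hk_pos : 0 < k := by rw [hk]; positivity
  simp only [← hk]
  have hs_ne : (s : ℂ) ≠ 0 := Complex.ofReal_ne_zero.2 hs.ne'
  have hk_ne : (k : ℂ) ≠ 0 := Complex.ofReal_ne_zero.2 hk_pos.ne'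
  have h_width : 1 / (4 * s) + t = 1 / (4 * (s / k)) := by
    rw [hk]
    field_simp
  have h_arg : -Complex.I * a / (2 * s) = -Complex.I * (a / k) / (2 * (s / k : ℝ)) := by
    push_cast
    field_simp
  have h_scalar : ((2 * s) ^ (μ + 1 / 2))⁻¹ =
      (k ^ (μ + 1 / 2))⁻¹ * ((2 * (s / k)) ^ (μ + 1 / 2))⁻¹ := by
    rw [← mul_inv, ← Real.mul_rpow (by positivity) (by positivity)]
    congr 2
    field_simp
  have h_exp : Complex.exp (a ^ 2 / (4 * s)) =
      Complex.exp (a ^ 2 * t / k) * Complex.exp ((a / k) ^ 2 / (4 * (s / k : ℝ))) := by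
    rw [← Complex.exp_add]
    congr 1
    push_cast
    field_simp
    rw [hk]
    push_cast
    ring
  refine (multiplier_eq_iff (memLp_top_exp_neg_mul_sq ht _)).2 ?_
  rw [map_smul, dunklTransform_gaussVec, dunklTransform_gaussVec, smul_smul]
  filter_upwards [coeFn_smul_gaussVec hμ _ _ _, coeFn_smul_gaussVec hμ _ _ _] with l h_left h_right
  rw [h_left, h_right, mul_left_comm (Real.exp _ : ℂ), exp_mul_gaussExp, h_width, h_arg, h_scalar,
    h_exp, Complex.ofReal_mul]
  ring

theorem heatKernel_eq (μ t x y : ℝ) :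
    heatKernel μ t x y = (1 / ((4 * t) ^ (μ + 1 / 2) * Real.Gamma (μ + 1 / 2)) *
      Real.exp (-x ^ 2 / (4 * t)) : ℝ) * gaussExp μ (1 / (4 * t)) (x / (2 * t)) y := by
  have h_exp : Real.exp (-(x ^ 2 + y ^ 2) / (4 * t)) =
      Real.exp (-x ^ 2 / (4 * t)) * Real.exp (-(1 / (4 * t)) * y ^ 2) := by
    rw [← Real.exp_add]
    congr 1
    ring
  rw [heatKernel, gaussExp, h_exp, ← mul_assoc, Complex.ofReal_mul, ← Complex.ofReal_exp,
    ← Complex.ofReal_mul]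
  push_cast
  ring_nf

theorem heatIntegrand_eq (μ t : ℝ) (f : ℝ → ℂ) (x y : ℝ) :
    heatIntegrand μ t f x y = |y| ^ (2 * μ) • (heatKernel μ t x y * f y) := by
  rw [heatIntegrand, Complex.real_smul, mul_comm]

include hμ in
theorem integrable_heatIntegrand {t : ℝ} (ht : 0 < t) (f : L2 μ) (x : ℝ) :
    Integrable fun y => heatIntegrand μ t f x y := by
  simp only [heatIntegrand_eq, ← integrable_weightMeasure_iff, heatKernel_eq]
  exact ((memLp_gaussExp hμ (by positivity) _).const_mul _).integrable_mul (Lp.memLp f)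

theorem heatOperator_eq_integral (μ t : ℝ) (f : ℝ → ℂ) (x : ℝ) :
    heatOperator μ t f x = (1 / ((4 * t) ^ (μ + 1 / 2) * Real.Gamma (μ + 1 / 2)) *
      Real.exp (-x ^ 2 / (4 * t)) : ℝ) *
        ∫ y, gaussExp μ (1 / (4 * t)) (x / (2 * t)) y * f y ∂(weightMeasure μ) := by
  rw [heatOperator, ← integral_const_mul, integral_weightMeasure]
  simp only [heatIntegrand_eq, heatKernel_eq, mul_assoc]

theorem heatOperator_eq_inner {t : ℝ} (ht : 0 < t) (f : L2 μ) (x : ℝ) :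
    heatOperator μ t f x = (1 / ((4 * t) ^ (μ + 1 / 2) * Real.Gamma (μ + 1 / 2)) *
      Real.exp (-x ^ 2 / (4 * t)) : ℝ) *
        ⟪gaussVec hμ (by positivity : 0 < 1 / (4 * t)) (x / (2 * t)), f⟫_ℂ := by
  rw [heatOperator_eq_integral, inner_gaussVec_left]
  simp only [map_div₀, map_mul, Complex.conj_ofReal, map_ofNat]

theorem heatOperator_gaussVec {s t : ℝ} (hs : 0 < s) (ht : 0 < t) (a : ℂ) (x : ℝ) :
    heatOperator μ t (gaussVec hμ hs a) x =
      (((1 + 4 * s * t) ^ (μ + 1 / 2))⁻¹ : ℝ) * Complex.exp (a ^ 2 * t / (1 + 4 * s * t : ℝ)) *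
        gaussExp μ (s / (1 + 4 * s * t)) (a / (1 + 4 * s * t : ℝ)) x := by
  obtain ⟨k, hk⟩ : ∃ k, k = 1 + 4 * s * t := ⟨_, rfl⟩
  have hk_pos : 0 < k := by rw [hk]; positivity
  simp only [← hk]
  have ht_ne : (t : ℂ) ≠ 0 := Complex.ofReal_ne_zero.2 ht.ne'
  have hk_ne : (k : ℂ) ≠ 0 := Complex.ofReal_ne_zero.2 hk_pos.ne'
  have hk' : (k : ℂ) = 1 + 4 * s * t := by rw [hk]; push_cast; rfl
  have h_add : 1 / (4 * t) + s = k / (4 * t) := by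
    rw [hk]
    field_simp
  have h_scalar : 1 / ((4 * t) ^ (μ + 1 / 2) * Real.Gamma (μ + 1 / 2)) *
      (Real.Gamma (μ + 1 / 2) * ((k / (4 * t)) ^ (μ + 1 / 2))⁻¹) = (k ^ (μ + 1 / 2))⁻¹ := by
    rw [Real.div_rpow hk_pos.le (by positivity), one_div, mul_inv, mul_assoc,
      inv_mul_cancel_left₀ (Gamma_add_half_pos hμ).ne', inv_div, inv_mul_eq_div,
      div_div_cancel_left' (by positivity)]
  have h_exp : Complex.exp ((-x ^ 2 / (4 * t) : ℝ) : ℂ) *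
      Complex.exp (((x / (2 * t) : ℂ) ^ 2 + a ^ 2) / (4 * (k / (4 * t) : ℝ))) =
      Complex.exp (a ^ 2 * t / k) * Complex.exp ((-(s / k) * x ^ 2 : ℝ) : ℂ) := by
    rw [← Complex.exp_add, ← Complex.exp_add]
    congr 1
    push_cast
    field_simp
    rw [hk']
    ring
  have h_arg : x / (2 * t) * a / (2 * (k / (4 * t) : ℝ)) = a / k * x := by
    push_cast
    field_simp
    ring
  rw [heatOperator_eq_inner hμ ht, inner_gaussVec, map_div₀, map_mul, Complex.conj_ofReal,
    map_ofNat, Complex.conj_ofReal, ← Complex.ofReal_add, h_add, h_arg, gaussExp, ← h_scalar,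
    Complex.ofReal_mul _ (Real.exp _), Complex.ofReal_mul (1 / _) (_ * _), Complex.ofReal_exp]
  linear_combination (1 / ((4 * t) ^ (μ + 1 / 2) * Real.Gamma (μ + 1 / 2)) : ℝ) *
    ((Real.Gamma (μ + 1 / 2) * ((k / (4 * t)) ^ (μ + 1 / 2))⁻¹ : ℝ) : ℂ) *
      genExp μ (a / k * x) * h_exp

theorem heatOperator_ae_eq_heatSemigroup {t : ℝ} (ht : 0 < t) (f : L2 μ) :
    heatOperator μ t f =ᵐ[weightMeasure μ] heatSemigroup hμ t f := by
  have h_inner : heatOperator μ t f = fun x =>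
      ((1 / ((4 * t) ^ (μ + 1 / 2) * Real.Gamma (μ + 1 / 2)) * Real.exp (-x ^ 2 / (4 * t)) : ℝ) •
        innerSL ℂ (gaussVec hμ (by positivity : 0 < 1 / (4 * t)) (x / (2 * t)))) f :=
    funext fun x => by
      rw [heatOperator_eq_inner hμ ht, smul_apply, innerSL_apply_apply, Complex.real_smul]
  rw [h_inner]
  refine ae_eq_apply_of_topologicalClosure_span_eq_top (topologicalClosure_span_gaussVec hμ)
    (fun x => _) (heatSemigroup hμ t) ?_ f
  rintro _ ⟨a, rfl⟩
  filter_upwards [coeFn_smul_gaussVec hμ _ _ _] with x hx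
  rw [smul_apply, innerSL_apply_apply, Complex.real_smul, ← heatOperator_eq_inner hμ ht,
    heatOperator_gaussVec hμ one_half_pos ht, heatSemigroup_gaussVec hμ one_half_pos ht.le, hx]

end HeatSemigroup

end BoseLike

end

theorem theorem3p10 (μ : ℝ) (hμ : -(1 / 2) < μ) :
    IsSelfAdjoint (BoseLike.momentum μ) ∧
    ∃ S : ℝ → BoseLike.L2 μ →L[ℂ] BoseLike.L2 μ,
      (∀ t : ℝ, 0 < t →
        IsBorelFunctionOf (BoseLike.momentum μ) (fun l => Real.exp (-t * l ^ 2)) (S t)) ∧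
      (∀ t : ℝ, 0 < t → ∀ f : BoseLike.L2 μ,
        (∀ x : ℝ, Integrable (fun y => BoseLike.heatIntegrand μ t f x y)) ∧
        BoseLike.heatOperator μ t f =ᵐ[BoseLike.weightMeasure μ] S t f) ∧
      (∀ s t : ℝ, 0 < s → 0 < t → S (s + t) = (S s).comp (S t)) ∧
      (∀ f : BoseLike.L2 μ, Tendsto (fun t => S t f) (𝓝[>] 0) (𝓝 f)) :=
  ⟨isSelfAdjoint_of_graph_eq_multiplierGraph aestronglyMeasurable_id (BoseLike.momentum_graph hμ),
    BoseLike.heatSemigroup hμ,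
    fun _ ht => BoseLike.isBorelFunctionOf_heatSemigroup hμ ht.le,
    fun _ ht f => ⟨BoseLike.integrable_heatIntegrand hμ ht f,
      BoseLike.heatOperator_ae_eq_heatSemigroup hμ ht f⟩,
    fun _ _ hs ht => BoseLike.heatSemigroup_add hμ hs.le ht.le,
    fun f => (BoseLike.tendsto_heatSemigroup hμ f).mono_left
      (nhdsWithin_mono _ Set.Ioi_subset_Ici_self)⟩
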